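/- Let $n\ge 2$, let $S^{n-1}=\{x\in\mathbb R^n:|x|=1\}$ carry the uniform probability measure $\sigma=\sigma_{n-1}$, and write $\mathrm{cov}_\sigma(f,g)=\int fg\,d\sigma-\int f\,d\sigma\int g\,d\sigma$. For a $C^1$ function $f:S^{n-1}\to\mathbb R$, the spherical gradient $\nabla_S f(x)$ is the shortest vector $w\in\mathbb R^n$ with $f(x')=f(x)+\langle w,x'-x\rangle+o(|x'-x|)$ as $x'\to x$, $x'\in S^{n-1}$, and $\|\nabla_S f\|_p$ denotes the $L^p(\sigma)$-norm of $|\nabla_S f|$, $1\le p\le\infty$. Let $$\psi_n(\alpha)=\frac{1}{2^{n-2}\,\Gamma(\frac n2)^2}\int_0^1(1-t^2)^{\frac{n-2}{2}}\int_0^\infty\!\!\int_0^\infty \exp\Big[-\frac{r^2+s^2-2rst\alpha}{2}\Big](rs)^{n-2}\,dr\,ds\,dt,\qquad |\alpha|\le 1,$$ $$c_n=\int_{S^{n-1}}\int_{S^{n-1}}\psi_n(\langle x,y\rangle)\,d\sigma(x)\,d\sigma(y).$$ If $n\ge 3$, then $\frac1{n-1}<c_n<\frac1{n-2}$. For all $n\ge2$,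 all $p,q\in[1,\infty]$ with $\frac1p+\frac1q=1$, and all $C^1$ functions $f,g:S^{n-1}\to\mathbb R$, $$|\mathrm{cov}_\sigma(f,g)|\le c_n\,\|\nabla_S f\|_p\,\|\nabla_S g\|_q .$$ In particular, if moreover $f$ is $1$-Lipschitz with respect to the geodesic distance on $S^{n-1}$ (for instance, with respect to the Euclidean distance), then $$|\mathrm{cov}_\sigma(f,g)|\le c_n\int_{S^{n-1}}|\nabla_S g|\,d\sigma .$$ -/

import Mathlib

open MeasureTheory ProbabilityTheory Set Filter Topology
open scoped ENNReal Manifold RealInnerProductSpace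

noncomputable section

namespace SphereCov

/-- The unit sphere of the Euclidean space `ℝⁿ`. -/
abbrev Sph (n : ℕ) : Type := Metric.sphere (0 : EuclideanSpace ℝ (Fin n)) 1

/-- The uniform probability measure on the unit sphere of `ℝⁿ`:
the surface measure divided by its total mass. -/
def unif (n : ℕ) : Measure (Sph n) :=
  ((volume : Measure (EuclideanSpace ℝ (Fin n))).toSphere univ)⁻¹ •
    (volume : Measure (EuclideanSpace ℝ (Fin n))).toSphere

/-- `w` satisfies the first order Taylor expansion of `f` at `x` along the sphere:
`f y = f x + ⟪w, y - x⟫ + o(|y - x|)` as `y → x` within the sphere. -/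
def IsTaylorVector {n : ℕ} (f : Sph n → ℝ) (x : Sph n) (w : EuclideanSpace ℝ (Fin n)) : Prop :=
  (fun y : Sph n => f y - f x - ⟪w, (y : EuclideanSpace ℝ (Fin n)) - x⟫) =o[𝓝 x]
    fun y : Sph n => (y : EuclideanSpace ℝ (Fin n)) - x

/-- `w` is the spherical gradient of `f` at `x`: a vector of smallest Euclidean norm among those
satisfying the first order Taylor expansion. -/
def IsSphericalGradient {n : ℕ} (f : Sph n → ℝ) (x : Sph n)
    (w : EuclideanSpace ℝ (Fin n)) : Prop :=
  IsTaylorVector f x w ∧ ∀ w', IsTaylorVector f x w' → ‖w‖ ≤ ‖w'‖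

/-- The spherical gradient is unique when it exists. -/
theorem IsSphericalGradient.unique {n : ℕ} {f : Sph n → ℝ} {x : Sph n}
    {v w : EuclideanSpace ℝ (Fin n)} (hv : IsSphericalGradient f x v)
    (hw : IsSphericalGradient f x w) : v = w := by
  have hnorm : ‖v‖ = ‖w‖ := le_antisymm (hv.2 w hw.1) (hw.2 v hv.1)
  have hmid : IsTaylorVector f x ((1 / 2 : ℝ) • (v + w)) := by
    have h := (hv.1.const_mul_left (1 / 2 : ℝ)).add (hw.1.const_mul_left (1 / 2 : ℝ))
    refine h.congr_left fun y => ?_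
    simp only [inner_smul_left, inner_add_left, RCLike.conj_to_real]
    ring
  have h1 := hv.2 _ hmid
  rw [norm_smul] at h1
  norm_num at h1
  have h2 := parallelogram_law_with_norm ℝ v w
  have h3 : ‖v - w‖ * ‖v - w‖ ≤ 0 := by
    nlinarith [norm_nonneg v, norm_nonneg (v + w)]
  have h4 : ‖v - w‖ = 0 := by nlinarith [norm_nonneg (v - w)]
  exact sub_eq_zero.mp (norm_eq_zero.mp h4)

open Classical in
/-- The spherical gradient `∇_S f` (with value `0` at points where it does not exist;
it exists everywhere for a continuously differentiable `f` ). -/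
def sgrad {n : ℕ} (f : Sph n → ℝ) (x : Sph n) : EuclideanSpace ℝ (Fin n) :=
  if h : ∃ w, IsSphericalGradient f x w then h.choose else 0

theorem IsSphericalGradient.sgrad_eq {n : ℕ} {f : Sph n → ℝ} {x : Sph n}
    {w : EuclideanSpace ℝ (Fin n)} (hw : IsSphericalGradient f x w) : sgrad f x = w := by
  have h : ∃ w, IsSphericalGradient f x w := ⟨w, hw⟩
  rw [sgrad, dif_pos h]
  exact h.choose_spec.unique hw

/-- The mixing density `ψₙ(α)`, `-1 ≤ α ≤ 1`, `n ≥ 2`, with values in `[0, ∞]`. -/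
def mixingDensity (n : ℕ) (α : ℝ) : ℝ≥0∞ :=
  ENNReal.ofReal (1 / (2 ^ (n - 2) * Real.Gamma ((n : ℝ) / 2) ^ 2)) *
    ∫⁻ t in Ioo (0 : ℝ) 1, ENNReal.ofReal (√(1 - t ^ 2) ^ (n - 2)) *
      ∫⁻ r in Ioi (0 : ℝ), ∫⁻ s in Ioi (0 : ℝ),
        ENNReal.ofReal (Real.exp (-(r ^ 2 + s ^ 2 - 2 * r * s * t * α) / 2) * (r * s) ^ (n - 2))

/-- The mixing measure `νₙ` on the product of two spheres, with density `ψₙ(⟪x, y⟫)` with respect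
to the product of the uniform measures. -/
def mixingMeasure (n : ℕ) : Measure (Sph n × Sph n) :=
  ((unif n).prod (unif n)).withDensity fun z =>
    mixingDensity n ⟪(z.1 : EuclideanSpace ℝ (Fin n)), (z.2 : EuclideanSpace ℝ (Fin n))⟫

/-- The constant `cₙ`: the total mass of the mixing measure `νₙ`. -/
def mixingConst (n : ℕ) : ℝ := (mixingMeasure n).real univ

/-- The norm `‖∇_S f‖_p` in `L^p` of the uniform measure, `1 ≤ p ≤ ∞`. -/
def gradNorm {n : ℕ} (f : Sph n → ℝ) (p : ℝ≥0∞) : ℝ :=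
  (eLpNorm (sgrad f) p (unif n)).toReal

end SphereCov

end

/-! The inequality is a Gaussian covariance formula transported to the sphere. Let X, Y be
independent standard Gaussian vectors in ℝⁿ and Z = tX + √(1-t²)Y. Then cov(u(X), v(X)) = E
u(X)(v(X) - v(Y)), and v(X) - v(Y) is the integral over 0 < t < 1 of the derivative of v along the
path t ↦ Z from Y to X. Gaussian integration by parts in X with Z held fixed turns this into ∫₀¹
E⟨∇u(X), ∇v(Z)⟩ dt. So |cov| is at most the integral of |∇u||∇v| against the law of (X, Z) averaged
over t (`gaussMix`, `covariance_gauss_le`).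

Take u(x) = f(x/|x|) and v(x) = g(x/|x|). The direction of X is uniform, so the Gaussian covariance
is the spherical one. The gradient of u is |x|⁻¹∇_S f(x/|x|), homogeneous of degree -1, and
integrating out the two radii leaves |∇_S f(x)||∇_S g(y)| integrated against the mixing measure
(`lintegral_gaussMix_of_homogeneous`). The extensions are singular at the origin. The factor
|x|²/(|x|²+ε) removes the singularity, and ε → 0 by dominated convergence with majorant
const/(|x||z|), whose integral is a multiple of cₙ (`enorm_covariance_le`). By rotation invariance
both marginals of the mixing measure are cₙσ, so Hölder's inequality concludes
(`lintegral_mixingMeasure_le`).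

Both bounds on cₙ are strict AM-GM. Since cₙ is the t-average of E 1/(|X||Z|), it lies below E|X|⁻²
= 1/(n-2). Conversely, the covariance bound applied to a coordinate x₀, with variance 1/n and |∇_S
x₀|² = 1 - x₀², gives 1/n < cₙ(1 - 1/n). -/

noncomputable section

namespace SphereCov

/-! ### Polar coordinates and the Mehler kernel -/

/-- Integration in polar coordinates. -/
theorem lintegral_polar {E : Type*} [NormedAddCommGroup E] [NormedSpace ℝ E] [FiniteDimensional ℝ E]
    [MeasurableSpace E] [BorelSpace E] [Nontrivial E] (μ : Measure E) [μ.IsAddHaarMeasure]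
    {φ : E → ℝ≥0∞} (hφ : Measurable φ) :
    ∫⁻ x, φ x ∂μ = ∫⁻ ω : Metric.sphere (0 : E) 1, (∫⁻ r in Ioi (0 : ℝ),
      ENNReal.ofReal (r ^ (Module.finrank ℝ E - 1)) * φ (r • (ω : E))) ∂μ.toSphere := by
  calc ∫⁻ x, φ x ∂μ = ∫⁻ x in ({0}ᶜ : Set E), φ x ∂μ := by
        rw [restrict_compl_singleton]
    _ = ∫⁻ x : ({0}ᶜ : Set E), φ x ∂(μ.comap (↑)) :=
        (lintegral_subtype_comap (measurableSet_singleton _).compl _).symm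
    _ = ∫⁻ p : Metric.sphere (0 : E) 1 × Ioi (0 : ℝ), φ (p.2.1 • (p.1 : E))
          ∂(μ.toSphere.prod (Measure.volumeIoiPow (Module.finrank ℝ E - 1))) := by
        rw [← μ.measurePreserving_homeomorphUnitSphereProd.lintegral_comp_emb
          (Homeomorph.measurableEmbedding _)]
        refine lintegral_congr fun x => ?_
        congr 1
        have hx : ‖(x : E)‖ ≠ 0 := norm_ne_zero_iff.2 x.2
        simp [smul_smul, hx]
    _ = _ := by
        rw [lintegral_prod _ (by fun_prop)]
        refine lintegral_congr fun ω => ?_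
        rw [Measure.volumeIoiPow, lintegral_withDensity_eq_lintegral_mul _ (by fun_prop)
          (by fun_prop)]
        exact lintegral_subtype_comap measurableSet_Ioi
          (fun r : ℝ => ENNReal.ofReal (r ^ (Module.finrank ℝ E - 1)) * φ (r • (ω : E)))

/-- The (unnormalized) density of a pair of correlated Gaussian vectors. -/
def mehlerKernel {E : Type*} [NormedAddCommGroup E] [InnerProductSpace ℝ E] (t : ℝ) (x z : E) : ℝ :=
  Real.exp (-(‖x‖ ^ 2 + ‖z‖ ^ 2 - 2 * t * ⟪x, z⟫) / 2)

/-! ### Averaged law of correlated Gaussian pairs -/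

section gaussMix

variable (E : Type*) [NormedAddCommGroup E] [InnerProductSpace ℝ E] [FiniteDimensional ℝ E]
  [MeasurableSpace E] [BorelSpace E]

/-- The law of a pair of standard Gaussian vectors with correlation `t`, averaged over
`0 < t < 1`. -/
def gaussMix : Measure (E × E) :=
  (((volume.restrict (Ioo (0 : ℝ) 1)).prod
    ((volume : Measure E).prod (volume : Measure E))).withDensity
    fun p => ENNReal.ofReal ((2 * Real.pi)⁻¹ ^ Module.finrank ℝ E) *
      (ENNReal.ofReal (√(1 - p.1 ^ 2) ^ Module.finrank ℝ E) *
        ENNReal.ofReal (mehlerKernel p.1 p.2.1 p.2.2))).map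
    fun p => (√(1 - p.1 ^ 2) • p.2.1, √(1 - p.1 ^ 2) • p.2.2)

variable {E}

@[fun_prop]
theorem measurable_mehlerKernel {α : Type*} [MeasurableSpace α] {t : α → ℝ} {x z : α → E}
    (ht : Measurable t) (hx : Measurable x) (hz : Measurable z) :
    Measurable fun a => mehlerKernel (t a) (x a) (z a) := by
  unfold mehlerKernel
  fun_prop

/-- Rescaling both vectors by s = √(1-t²) clears the denominator 1-t² from the exponent of the
correlated Gaussian density. The Jacobian s²ⁿ against the normalization s⁻ⁿ leaves the weight sⁿ,
where n is the dimension. -/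
theorem lintegral_gaussMix {Φ : E × E → ℝ≥0∞} (hΦ : Measurable Φ) :
    ∫⁻ p, Φ p ∂gaussMix E = ENNReal.ofReal ((2 * Real.pi)⁻¹ ^ Module.finrank ℝ E) *
      ∫⁻ t in Ioo (0 : ℝ) 1, ENNReal.ofReal (√(1 - t ^ 2) ^ Module.finrank ℝ E) *
        ∫⁻ x : E, ∫⁻ z : E, Φ (√(1 - t ^ 2) • x, √(1 - t ^ 2) • z) *
          ENNReal.ofReal (mehlerKernel t x z) := by
  rw [gaussMix, lintegral_map hΦ (by fun_prop), lintegral_withDensity_eq_lintegral_mul _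
    (by fun_prop) (by fun_prop), lintegral_prod _ (by fun_prop)]
  simp only [Pi.mul_apply]
  rw [← lintegral_const_mul _ (by fun_prop)]
  refine lintegral_congr fun t => ?_
  rw [lintegral_prod _ (by fun_prop), ← mul_assoc, ← lintegral_const_mul _ (by fun_prop)]
  refine lintegral_congr fun x => ?_
  rw [← lintegral_const_mul _ (by fun_prop)]
  refine lintegral_congr fun z => ?_
  ring

end gaussMix

/-! ### From Gaussian pairs to the mixing measure -/

/-- The integral over the quadrant in the definition of `mixingDensity`. -/
def quadrantIntegral (n : ℕ) (t α : ℝ) : ℝ≥0∞ :=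
  ∫⁻ r in Ioi (0 : ℝ), ∫⁻ s in Ioi (0 : ℝ),
    ENNReal.ofReal (Real.exp (-(r ^ 2 + s ^ 2 - 2 * r * s * t * α) / 2) * (r * s) ^ (n - 2))

@[fun_prop]
theorem measurable_quadrantIntegral (n : ℕ) {β : Type*} [MeasurableSpace β] {t α : β → ℝ}
    (ht : Measurable t) (hα : Measurable α) :
    Measurable fun b => quadrantIntegral n (t b) (α b) := by
  unfold quadrantIntegral
  refine Measurable.lintegral_prod_right' (f := fun p : β × ℝ => ∫⁻ s in Ioi (0 : ℝ),
    ENNReal.ofReal (Real.exp (-(p.2 ^ 2 + s ^ 2 - 2 * p.2 * s * t p.1 * α p.1) / 2) *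
      (p.2 * s) ^ (n - 2))) ?_
  refine Measurable.lintegral_prod_right' (f := fun p : (β × ℝ) × ℝ =>
    ENNReal.ofReal (Real.exp (-(p.1.2 ^ 2 + p.2 ^ 2 - 2 * p.1.2 * p.2 * t p.1.1 * α p.1.1) / 2) *
      (p.1.2 * p.2) ^ (n - 2))) ?_
  fun_prop

theorem mixingDensity_eq (n : ℕ) (α : ℝ) : mixingDensity n α =
    ENNReal.ofReal (1 / (2 ^ (n - 2) * Real.Gamma ((n : ℝ) / 2) ^ 2)) *
    ∫⁻ t in Ioo (0 : ℝ) 1, ENNReal.ofReal (√(1 - t ^ 2) ^ (n - 2)) * quadrantIntegral n t α := rfl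

@[fun_prop]
theorem measurable_mixingDensity (n : ℕ) : Measurable (mixingDensity n) := by
  simp only [funext (mixingDensity_eq n)]
  refine Measurable.const_mul ?_ _
  refine Measurable.lintegral_prod_right' (f := fun p : ℝ × ℝ =>
    ENNReal.ofReal (√(1 - p.2 ^ 2) ^ (n - 2)) * quadrantIntegral n p.2 p.1) ?_
  fun_prop

/-- The total mass of the surface measure of the unit sphere. -/
theorem toSphere_univ (n : ℕ) (hn : 1 ≤ n) :
    (volume : Measure (EuclideanSpace ℝ (Fin n))).toSphere univ =
      ENNReal.ofReal (2 * √Real.pi ^ n / Real.Gamma ((n : ℝ) / 2)) := by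
  have : Nonempty (Fin n) := ⟨⟨0, hn⟩⟩
  have hn' : (0 : ℝ) < n := by exact_mod_cast hn
  have hΓ : 0 < Real.Gamma ((n : ℝ) / 2) := Real.Gamma_pos_of_pos (by positivity)
  rw [Measure.toSphere_apply_univ, EuclideanSpace.volume_ball, finrank_euclideanSpace,
    Fintype.card_fin, ENNReal.ofReal_one, one_pow, one_mul, ← ENNReal.ofReal_natCast,
    ← ENNReal.ofReal_mul hn'.le, Real.Gamma_add_one (by positivity)]
  congr 1
  field_simp

/-- This accounts for the prefactor of ψₙ: polar coordinates in each variable produce the area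
2π^{n/2}/Γ(n/2) twice, and the Gaussian pair is normalized by (2π)⁻ⁿ. -/
theorem mixingDensity_const (n : ℕ) (hn : 2 ≤ n) :
    (volume : Measure (EuclideanSpace ℝ (Fin n))).toSphere univ ^ 2 *
      ENNReal.ofReal ((2 * Real.pi)⁻¹ ^ n) =
    ENNReal.ofReal (1 / (2 ^ (n - 2) * Real.Gamma ((n : ℝ) / 2) ^ 2)) := by
  have hn' : (0 : ℝ) < n := by exact_mod_cast (by omega : 0 < n)
  have hΓ : 0 < Real.Gamma ((n : ℝ) / 2) := Real.Gamma_pos_of_pos (by positivity)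
  rw [toSphere_univ n (by omega), ← ENNReal.ofReal_pow (by positivity),
    ← ENNReal.ofReal_mul (by positivity)]
  congr 1
  obtain ⟨k, rfl⟩ := Nat.exists_eq_add_of_le hn
  have h : √Real.pi ^ 2 = Real.pi := Real.sq_sqrt Real.pi_pos.le
  have h2 : (√Real.pi ^ (2 + k)) ^ 2 = Real.pi ^ (2 + k) := by
    rw [← pow_mul, mul_comm, pow_mul, h]
  rw [div_pow, mul_pow, h2, Nat.add_sub_cancel_left, inv_pow, mul_pow]
  field_simp
  ring

theorem toSphere_eq_smul_unif (n : ℕ) (hn : 1 ≤ n) :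
    (volume : Measure (EuclideanSpace ℝ (Fin n))).toSphere =
      (volume : Measure (EuclideanSpace ℝ (Fin n))).toSphere univ • unif n := by
  have : Nonempty (Fin n) := ⟨⟨0, hn⟩⟩
  rw [unif, smul_smul, ENNReal.mul_inv_cancel, one_smul]
  · exact Measure.measure_univ_ne_zero.2 (Measure.toSphere_ne_zero _)
  · exact measure_ne_top _ _

theorem isProbabilityMeasure_unif (n : ℕ) (hn : 1 ≤ n) : IsProbabilityMeasure (unif n) := by
  have : Nonempty (Fin n) := ⟨⟨0, hn⟩⟩
  constructor
  rw [unif, Measure.smul_apply, smul_eq_mul, ENNReal.inv_mul_cancel]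
  · exact Measure.measure_univ_ne_zero.2 (Measure.toSphere_ne_zero _)
  · exact measure_ne_top _ _

theorem lintegral_polar_unif {n : ℕ} (hn : 1 ≤ n) {φ : EuclideanSpace ℝ (Fin n) → ℝ≥0∞}
    (hφ : Measurable φ) :
    ∫⁻ x, φ x = (volume : Measure (EuclideanSpace ℝ (Fin n))).toSphere univ *
      ∫⁻ ω, (∫⁻ r in Ioi (0 : ℝ), ENNReal.ofReal (r ^ (n - 1)) *
        φ (r • (ω : EuclideanSpace ℝ (Fin n)))) ∂unif n := by
  have : Nonempty (Fin n) := ⟨⟨0, hn⟩⟩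
  rw [lintegral_polar volume hφ]
  conv_lhs => rw [toSphere_eq_smul_unif n hn, lintegral_smul_measure]
  simp

/-- Polar coordinates for a homogeneous function integrated against the Mehler kernel. -/
theorem lintegral_mehlerKernel_of_homogeneous {n : ℕ} (hn : 2 ≤ n)
    {F G : EuclideanSpace ℝ (Fin n) → ℝ≥0∞} (hF : Measurable F) (hG : Measurable G)
    (hF' : ∀ r : ℝ, 0 < r → ∀ x, F (r • x) = ENNReal.ofReal r⁻¹ * F x)
    (hG' : ∀ r : ℝ, 0 < r → ∀ x, G (r • x) = ENNReal.ofReal r⁻¹ * G x) (t : ℝ) :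
    ∫⁻ x, ∫⁻ z, F x * G z * ENNReal.ofReal (mehlerKernel t x z) =
    (volume : Measure (EuclideanSpace ℝ (Fin n))).toSphere univ ^ 2 *
      ∫⁻ ω, ∫⁻ ξ, F ω * G ξ * quadrantIntegral n t
        ⟪(ω : EuclideanSpace ℝ (Fin n)), (ξ : EuclideanSpace ℝ (Fin n))⟫ ∂unif n ∂unif n := by
  have := isProbabilityMeasure_unif n (by omega)
  have hm1 : Measurable fun p : EuclideanSpace ℝ (Fin n) × EuclideanSpace ℝ (Fin n) =>
      F p.1 * G p.2 * ENNReal.ofReal (mehlerKernel t p.1 p.2) := by fun_prop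
  rw [lintegral_polar_unif (by omega) hm1.lintegral_prod_right', sq, mul_assoc]
  congr 1
  rw [← lintegral_const_mul']
  swap
  · exact measure_ne_top _ _
  refine lintegral_congr fun ω => ?_
  have key : ∀ r : ℝ, 0 < r → ∫⁻ z, F (r • (ω : EuclideanSpace ℝ (Fin n))) * G z *
      ENNReal.ofReal (mehlerKernel t (r • (ω : EuclideanSpace ℝ (Fin n))) z) =
      (volume : Measure (EuclideanSpace ℝ (Fin n))).toSphere univ *
      ∫⁻ ξ, (∫⁻ ρ in Ioi (0 : ℝ), ENNReal.ofReal (ρ ^ (n - 1)) *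
        (F (r • (ω : EuclideanSpace ℝ (Fin n))) * G (ρ • (ξ : EuclideanSpace ℝ (Fin n))) *
      ENNReal.ofReal (mehlerKernel t (r • (ω : EuclideanSpace ℝ (Fin n)))
        (ρ • (ξ : EuclideanSpace ℝ (Fin n)))))) ∂unif n := fun r _ =>
    lintegral_polar_unif (by omega) (by fun_prop)
  rw [setLIntegral_congr_fun measurableSet_Ioi fun r hr => by rw [key r hr]]
  simp_rw [mul_left_comm _ ((volume : Measure (EuclideanSpace ℝ (Fin n))).toSphere univ)]
  rw [lintegral_const_mul' _ _ (measure_ne_top _ _)]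
  congr 1
  have hm2 : Measurable fun p : (ℝ × Sph n) × ℝ => ENNReal.ofReal (p.2 ^ (n - 1)) *
        (F (p.1.1 • (ω : EuclideanSpace ℝ (Fin n))) *
          G (p.2 • (p.1.2 : EuclideanSpace ℝ (Fin n))) *
      ENNReal.ofReal (mehlerKernel t (p.1.1 • (ω : EuclideanSpace ℝ (Fin n)))
        (p.2 • (p.1.2 : EuclideanSpace ℝ (Fin n))))) := by fun_prop
  have hm3 := Measurable.lintegral_prod_right' (ν := volume.restrict (Ioi 0)) hm2
  have hc : ∀ r : ℝ, ENNReal.ofReal (r ^ (n - 1)) ≠ ∞ := fun r => ENNReal.ofReal_ne_top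
  simp_rw [← lintegral_const_mul' _ _ (hc _)]
  rw [lintegral_lintegral_swap]
  swap
  · apply Measurable.aemeasurable
    simp_rw [Function.uncurry_def, lintegral_const_mul' _ _ (hc _)]
    exact Measurable.mul (by fun_prop) hm3
  refine lintegral_congr fun ξ => ?_
  unfold quadrantIntegral
  rw [← lintegral_const_mul]
  swap
  · refine Measurable.lintegral_prod_right' (f := fun p : ℝ × ℝ => ENNReal.ofReal
      (Real.exp (-(p.1 ^ 2 + p.2 ^ 2 - 2 * p.1 * p.2 * t *
        ⟪(ω : EuclideanSpace ℝ (Fin n)), (ξ : EuclideanSpace ℝ (Fin n))⟫) / 2) *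
        (p.1 * p.2) ^ (n - 2))) ?_
    fun_prop
  refine setLIntegral_congr_fun measurableSet_Ioi fun r (hr : 0 < r) => ?_
  rw [← lintegral_const_mul _ (by fun_prop)]
  refine setLIntegral_congr_fun measurableSet_Ioi fun ρ (hρ : 0 < ρ) => ?_
  rw [hF' r hr, hG' ρ hρ]
  have e1 : mehlerKernel t (r • (ω : EuclideanSpace ℝ (Fin n)))
        (ρ • (ξ : EuclideanSpace ℝ (Fin n))) = Real.exp (-(r ^ 2 + ρ ^ 2 - 2 * r * ρ * t *
        ⟪(ω : EuclideanSpace ℝ (Fin n)), (ξ : EuclideanSpace ℝ (Fin n))⟫) / 2) := by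
    simp only [mehlerKernel, norm_smul, Real.norm_eq_abs, abs_of_pos hr, abs_of_pos hρ,
      norm_eq_of_mem_sphere, inner_smul_left, inner_smul_right]
    congr 1
    simp
    ring
  rw [e1, ENNReal.ofReal_mul (by positivity)]
  -- Each radius carries the polar weight of exponent n-1 and a factor of degree -1 from
  -- homogeneity, whence the exponent n-2 in ψₙ.
  have e2 : ENNReal.ofReal ((r * ρ) ^ (n - 2)) = ENNReal.ofReal (r ^ (n - 1)) *
      ENNReal.ofReal (ρ ^ (n - 1)) * ENNReal.ofReal r⁻¹ * ENNReal.ofReal ρ⁻¹ := by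
    rw [← ENNReal.ofReal_mul (by positivity), ← ENNReal.ofReal_mul (by positivity),
      ← ENNReal.ofReal_mul (by positivity)]
    congr 1
    obtain ⟨k, rfl⟩ := Nat.exists_eq_add_of_le hn
    have : 2 + k - 1 = k + 1 := by omega
    rw [this, Nat.add_sub_cancel_left]
    field_simp
    ring
  rw [e2]
  ring

/-- On products of functions that are homogeneous of degree `-1`, integration of a mixture of
correlated Gaussian pairs is integration against the mixing measure on the spheres. -/
theorem lintegral_gaussMix_of_homogeneous {n : ℕ} (hn : 2 ≤ n)
    {F G : EuclideanSpace ℝ (Fin n) → ℝ≥0∞} (hF : Measurable F) (hG : Measurable G)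
    (hF' : ∀ r : ℝ, 0 < r → ∀ x, F (r • x) = ENNReal.ofReal r⁻¹ * F x)
    (hG' : ∀ r : ℝ, 0 < r → ∀ x, G (r • x) = ENNReal.ofReal r⁻¹ * G x) :
    ∫⁻ p, F p.1 * G p.2 ∂gaussMix (EuclideanSpace ℝ (Fin n)) =
      ∫⁻ p : Sph n × Sph n, F p.1 * G p.2 ∂mixingMeasure n := by
  have := isProbabilityMeasure_unif n (by omega)
  have hmd : Measurable fun p : Sph n × Sph n => mixingDensity n
      ⟪(p.1 : EuclideanSpace ℝ (Fin n)), (p.2 : EuclideanSpace ℝ (Fin n))⟫ := by fun_prop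
  rw [lintegral_gaussMix (by fun_prop), mixingMeasure,
    lintegral_withDensity_eq_lintegral_mul _ hmd (by fun_prop), lintegral_prod _ (by fun_prop)]
  simp only [Pi.mul_apply, finrank_euclideanSpace, Fintype.card_fin, mixingDensity_eq]
  rw [← mixingDensity_const n hn]
  have step : ∀ t ∈ Ioo (0 : ℝ) 1, ENNReal.ofReal (√(1 - t ^ 2) ^ n) *
      ∫⁻ x, ∫⁻ z, F (√(1 - t ^ 2) • x) * G (√(1 - t ^ 2) • z) *
        ENNReal.ofReal (mehlerKernel t x z) =
      (volume : Measure (EuclideanSpace ℝ (Fin n))).toSphere univ ^ 2 *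
      ∫⁻ q : Sph n × Sph n, F q.1 * G q.2 * (ENNReal.ofReal (√(1 - t ^ 2) ^ (n - 2)) *
        quadrantIntegral n t ⟪(q.1 : EuclideanSpace ℝ (Fin n)), (q.2 : EuclideanSpace ℝ (Fin n))⟫)
        ∂((unif n).prod (unif n)) := by
    intro t ht
    have hs : 0 < √(1 - t ^ 2) := Real.sqrt_pos.2 (by nlinarith [ht.1, ht.2])
    set s := √(1 - t ^ 2)
    -- Homogeneity turns the two rescalings by s into a factor s⁻², which reduces the weight sⁿ to
    -- the power n-2 appearing in ψₙ.
    have e1 : ∀ x z, F (s • x) * G (s • z) * ENNReal.ofReal (mehlerKernel t x z) =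
        ENNReal.ofReal (s⁻¹ ^ 2) * (F x * G z * ENNReal.ofReal (mehlerKernel t x z)) := by
      intro x z
      rw [hF' s hs, hG' s hs, ENNReal.ofReal_pow (by positivity)]
      ring
    simp_rw [e1, lintegral_const_mul' _ _ ENNReal.ofReal_ne_top]
    rw [lintegral_mehlerKernel_of_homogeneous hn hF hG hF' hG', ← mul_assoc,
      ← ENNReal.ofReal_mul (by positivity), mul_left_comm]
    have e2 : s ^ n * s⁻¹ ^ 2 = s ^ (n - 2) := by
      obtain ⟨k, rfl⟩ := Nat.exists_eq_add_of_le hn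
      rw [Nat.add_sub_cancel_left]
      field_simp
      ring
    rw [e2]
    congr 1
    rw [lintegral_prod _ (by fun_prop), ← lintegral_const_mul' _ _ ENNReal.ofReal_ne_top]
    refine lintegral_congr fun ω => ?_
    rw [← lintegral_const_mul' _ _ ENNReal.ofReal_ne_top]
    refine lintegral_congr fun ξ => ?_
    ring
  rw [setLIntegral_congr_fun measurableSet_Ioo step, lintegral_const_mul', ← mul_assoc,
    mul_comm (ENNReal.ofReal _) (_ ^ 2)]
  swap
  · exact ENNReal.pow_ne_top (measure_ne_top _ _)
  rw [lintegral_lintegral_swap (by fun_prop), ← lintegral_const_mul', lintegral_prod]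
  rotate_left
  · fun_prop
  · exact ENNReal.mul_ne_top (ENNReal.pow_ne_top (measure_ne_top _ _)) ENNReal.ofReal_ne_top
  refine lintegral_congr fun ω => ?_
  refine lintegral_congr fun ξ => ?_
  dsimp only
  rw [lintegral_const_mul _ (by fun_prop)]
  ring

/-! ### Standard Gaussian measure and the marginals of the pairs -/

section gauss

variable (E : Type*) [NormedAddCommGroup E] [InnerProductSpace ℝ E] [FiniteDimensional ℝ E]
  [MeasurableSpace E] [BorelSpace E]

/-- The standard Gaussian measure on a Euclidean space. -/
def gauss : Measure E :=
  (volume : Measure E).withDensity fun x =>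
    ENNReal.ofReal ((√(2 * Real.pi))⁻¹ ^ Module.finrank ℝ E * Real.exp (-‖x‖ ^ 2 / 2))

variable {E}

theorem integrable_exp_neg_mul_sq_norm {b : ℝ} (hb : 0 < b) :
    Integrable fun x : E => Real.exp (-b * ‖x‖ ^ 2) := by
  have h := GaussianFourier.integrable_cexp_neg_mul_sq_norm_add (V := E) (b := (b : ℂ))
    (by simpa using hb) 0 0
  have h2 := h.norm
  refine h2.congr (Eventually.of_forall fun x => ?_)
  simp only [Complex.norm_exp]
  congr 1
  simp [← Complex.ofReal_pow]

theorem lintegral_exp_neg_mul_sq_norm {s : ℝ} (hs : 0 < s) :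
    ∫⁻ x : E, ENNReal.ofReal (Real.exp (-(s * ‖x‖) ^ 2 / 2)) =
      ENNReal.ofReal ((√(2 * Real.pi) / s) ^ Module.finrank ℝ E) := by
  have hb : 0 < s ^ 2 / 2 := by positivity
  have e : ∀ x : E, Real.exp (-(s * ‖x‖) ^ 2 / 2) = Real.exp (-(s ^ 2 / 2) * ‖x‖ ^ 2) := by
    intro x; congr 1; ring
  simp_rw [e]
  rw [← ofReal_integral_eq_lintegral_ofReal (integrable_exp_neg_mul_sq_norm hb)
    (Eventually.of_forall fun x => (Real.exp_pos _).le),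
    GaussianFourier.integral_rexp_neg_mul_sq_norm hb]
  congr 1
  have h1 : Real.pi / (s ^ 2 / 2) = (√(2 * Real.pi) / s) ^ 2 := by
    rw [div_pow, Real.sq_sqrt (by positivity)]
    field_simp
  rw [h1, ← Real.rpow_natCast, ← Real.rpow_natCast, ← Real.rpow_mul (by positivity)]
  congr 1
  push_cast
  ring

theorem lintegral_gauss {Φ : E → ℝ≥0∞} (hΦ : Measurable Φ) :
    ∫⁻ x, Φ x ∂gauss E = ENNReal.ofReal ((√(2 * Real.pi))⁻¹ ^ Module.finrank ℝ E) *
      ∫⁻ x, Φ x * ENNReal.ofReal (Real.exp (-‖x‖ ^ 2 / 2)) := by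
  rw [gauss, lintegral_withDensity_eq_lintegral_mul _ (by fun_prop) hΦ,
    ← lintegral_const_mul' _ _ ENNReal.ofReal_ne_top]
  refine lintegral_congr fun x => ?_
  rw [Pi.mul_apply, ENNReal.ofReal_mul (by positivity)]
  ring

instance : IsProbabilityMeasure (gauss E) := by
  constructor
  rw [← lintegral_one, lintegral_gauss measurable_const]
  have h := lintegral_exp_neg_mul_sq_norm (E := E) one_pos
  simp only [one_mul, div_one] at h ⊢
  rw [h, ← ENNReal.ofReal_mul (by positivity), ← mul_pow, inv_mul_cancel₀ (by positivity)]
  simp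

theorem lintegral_comp_smul (Φ : E → ℝ≥0∞) {s : ℝ} (hs : 0 < s) :
    ENNReal.ofReal (s ^ Module.finrank ℝ E) * ∫⁻ x : E, Φ (s • x) = ∫⁻ x, Φ x := by
  have h := (Homeomorph.smulOfNeZero s hs.ne' (α := E)).measurableEmbedding.lintegral_map
    (μ := volume) Φ
  change ∫⁻ x, Φ x ∂(volume.map (s • ·)) = ∫⁻ x, Φ (s • x) at h
  rw [← h, Measure.map_addHaar_smul _ hs.ne', lintegral_smul_measure, smul_eq_mul, ← mul_assoc,
    ← ENNReal.ofReal_mul (by positivity), abs_of_pos (by positivity), mul_inv_cancel₀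
    (by positivity)]
  simp

/-- Completing the square in z writes the exponent as -(1-t²)|x|²/2 - |z - tx|²/2. The z-integral is
then that of a translated Gaussian. -/
theorem lintegral_mehlerKernel (t : ℝ) (ht : t ∈ Ioo (0 : ℝ) 1) (x : E) :
    ∫⁻ z, ENNReal.ofReal (mehlerKernel t x z) =
      ENNReal.ofReal (√(2 * Real.pi) ^ Module.finrank ℝ E *
      Real.exp (-‖√(1 - t ^ 2) • x‖ ^ 2 / 2)) := by
  have h1 : ∀ z, mehlerKernel t x z = Real.exp (-‖√(1 - t ^ 2) • x‖ ^ 2 / 2) *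
      Real.exp (-(1 * ‖z - t • x‖) ^ 2 / 2) := by
    intro z
    rw [mehlerKernel, ← Real.exp_add, norm_smul, mul_pow, Real.norm_eq_abs, sq_abs,
      Real.sq_sqrt (by nlinarith [ht.1, ht.2]), one_mul, norm_sub_sq_real, norm_smul,
      inner_smul_right, mul_pow, Real.norm_eq_abs, sq_abs, real_inner_comm]
    congr 1
    ring
  simp_rw [h1, ENNReal.ofReal_mul (Real.exp_pos _).le]
  rw [lintegral_const_mul' _ _ ENNReal.ofReal_ne_top,
    lintegral_sub_right_eq_self (fun z : E => ENNReal.ofReal (Real.exp (-(1 * ‖z‖) ^ 2 / 2))),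
    lintegral_exp_neg_mul_sq_norm one_pos, ENNReal.ofReal_mul (by positivity), mul_comm, div_one]

/-- For each t, integrating out z and undoing the scaling gives the standard Gaussian, independently
of t; the interval of averaging has length one. -/
theorem gaussMix_map_fst : (gaussMix E).map Prod.fst = gauss E := by
  refine Measure.ext_of_lintegral _ fun Φ hΦ => ?_
  rw [lintegral_map hΦ measurable_fst, lintegral_gaussMix (by fun_prop), lintegral_gauss hΦ]
  have step : ∀ t ∈ Ioo (0 : ℝ) 1, ENNReal.ofReal (√(1 - t ^ 2) ^ Module.finrank ℝ E) *
        ∫⁻ x : E, ∫⁻ z : E, Φ (√(1 - t ^ 2) • x) * ENNReal.ofReal (mehlerKernel t x z) =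
      ENNReal.ofReal (√(2 * Real.pi) ^ Module.finrank ℝ E) *
        ∫⁻ x : E, Φ x * ENNReal.ofReal (Real.exp (-‖x‖ ^ 2 / 2)) := by
    intro t ht
    have hs : 0 < √(1 - t ^ 2) := Real.sqrt_pos.2 (by nlinarith [ht.1, ht.2])
    rw [← lintegral_comp_smul (fun x => Φ x * ENNReal.ofReal (Real.exp (-‖x‖ ^ 2 / 2))) hs,
      mul_left_comm]
    congr 1
    rw [← lintegral_const_mul' _ _ ENNReal.ofReal_ne_top]
    refine lintegral_congr fun x => ?_
    rw [lintegral_const_mul _ (by fun_prop), lintegral_mehlerKernel t ht,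
      ENNReal.ofReal_mul (by positivity)]
    ring
  rw [setLIntegral_congr_fun measurableSet_Ioo step, setLIntegral_const, Real.volume_Ioo, sub_zero,
    ENNReal.ofReal_one, mul_one, ← mul_assoc, ← ENNReal.ofReal_mul (by positivity), ← mul_pow]
  congr 3
  have h : √(2 * Real.pi) ^ 2 = 2 * Real.pi := Real.sq_sqrt (by positivity)
  field_simp
  rw [h]

theorem gaussMix_map_swap : (gaussMix E).map Prod.swap = gaussMix E := by
  refine Measure.ext_of_lintegral _ fun Φ hΦ => ?_
  rw [lintegral_map hΦ measurable_swap, lintegral_gaussMix (by fun_prop), lintegral_gaussMix hΦ]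
  congr 1
  refine lintegral_congr fun t => ?_
  congr 1
  rw [lintegral_lintegral_swap (by fun_prop)]
  refine lintegral_congr fun z => lintegral_congr fun x => ?_
  simp only [Prod.swap_prod_mk, mehlerKernel, real_inner_comm x z, add_comm (‖x‖ ^ 2)]

theorem gaussMix_map_snd : (gaussMix E).map Prod.snd = gauss E := by
  rw [← gaussMix_map_fst, ← gaussMix_map_swap, Measure.map_map measurable_snd measurable_swap]
  conv_rhs => rw [gaussMix_map_swap]
  rfl

instance : IsProbabilityMeasure (gaussMix E) := by
  constructor
  have h := Measure.map_apply (μ := gaussMix E) measurable_fst MeasurableSet.univ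
  rw [gaussMix_map_fst, measure_univ, preimage_univ] at h
  exact h.symm

/-- For fixed t and x the exceptional z form a sphere about the origin, a null set. This is what
makes the AM-GM bound for cₙ strict. -/
theorem gaussMix_ae_norm_ne [Nontrivial E] : ∀ᵐ p ∂gaussMix E, ‖p.1‖ ≠ ‖p.2‖ := by
  have hs : MeasurableSet {p : E × E | ‖p.1‖ = ‖p.2‖} :=
    measurableSet_eq_fun (by fun_prop) (by fun_prop)
  rw [ae_iff]
  simp only [ne_eq, not_not]
  rw [← lintegral_indicator_one hs, lintegral_gaussMix (measurable_one.indicator hs)]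
  refine mul_eq_zero_of_right _ ((setLIntegral_congr_fun measurableSet_Ioo fun t ht => ?_).trans
    (lintegral_zero))
  refine mul_eq_zero_of_right _ ((lintegral_congr fun x => ?_).trans lintegral_zero)
  have hs0 : √(1 - t ^ 2) ≠ 0 := (Real.sqrt_pos.2 (by nlinarith [ht.1, ht.2])).ne'
  refine (lintegral_congr_ae ?_).trans lintegral_zero
  filter_upwards [measure_eq_zero_iff_ae_notMem.1 (Measure.addHaar_sphere volume (0 : E) ‖x‖)]
    with z hz
  rw [indicator_of_notMem, zero_mul]
  intro h
  simp only [mem_ofPred_eq, norm_smul] at h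
  exact hz (by simpa using (mul_left_cancel₀ (norm_ne_zero_iff.2 hs0) h).symm)

end gauss

/-! ### Radial and angular parts of the Gaussian measure -/

section radial

variable {n : ℕ} [NeZero n]

/-- The direction `x / |x|` of a vector (a fixed unit vector if `x = 0`). -/
def dir (x : EuclideanSpace ℝ (Fin n)) : Sph n :=
  ⟨if x = 0 then EuclideanSpace.single 0 1 else ‖x‖⁻¹ • x, by
    split_ifs with h
    · simp
    · simp [norm_smul, h]⟩

theorem dir_coe {x : EuclideanSpace ℝ (Fin n)} (hx : x ≠ 0) :
    (dir x : EuclideanSpace ℝ (Fin n)) = ‖x‖⁻¹ • x := by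
  simp [dir, hx]

@[fun_prop]
theorem measurable_dir : Measurable (dir : EuclideanSpace ℝ (Fin n) → Sph n) :=
  Measurable.subtype_mk (Measurable.ite (measurableSet_singleton _) (by fun_prop) (by fun_prop))

theorem dir_smul {r : ℝ} (hr : 0 < r) (x : EuclideanSpace ℝ (Fin n)) : dir (r • x) = dir x := by
  rcases eq_or_ne x 0 with rfl | hx
  · simp
  · apply Subtype.ext
    rw [dir_coe hx, dir_coe (smul_ne_zero hr.ne' hx), norm_smul, Real.norm_eq_abs, abs_of_pos hr,
      smul_smul]
    congr 1
    field_simp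

theorem dir_sphere (ω : Sph n) : dir (ω : EuclideanSpace ℝ (Fin n)) = ω := by
  apply Subtype.ext
  have h : ‖(ω : EuclideanSpace ℝ (Fin n))‖ = 1 := norm_eq_of_mem_sphere ω
  rw [dir_coe (by rw [← norm_ne_zero_iff, h]; exact one_ne_zero), h]
  simp

/-- The multiplier k separates the radial integral from the angular one. It is used with k = 1 for
functions of the direction and with k(r) = r⁻² for the second negative moment. -/
theorem lintegral_gauss_radial {Φ : EuclideanSpace ℝ (Fin n) → ℝ≥0∞} (hΦ : Measurable Φ)
    {k : ℝ → ℝ≥0∞} (hk : ∀ r : ℝ, 0 < r → ∀ x, Φ (r • x) = k r * Φ x) (hkm : Measurable k) :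
    ∫⁻ x, Φ x ∂gauss (EuclideanSpace ℝ (Fin n)) =
      ENNReal.ofReal ((√(2 * Real.pi))⁻¹ ^ n) *
        (volume : Measure (EuclideanSpace ℝ (Fin n))).toSphere univ *
        (∫⁻ r in Ioi (0 : ℝ), k r * ENNReal.ofReal (r ^ (n - 1) * Real.exp (-r ^ 2 / 2))) *
        ∫⁻ ω, Φ ω ∂unif n := by
  have hn : 1 ≤ n := Nat.one_le_iff_ne_zero.2 (NeZero.ne n)
  rw [lintegral_gauss hΦ, finrank_euclideanSpace, Fintype.card_fin,
    lintegral_polar_unif hn (by fun_prop), mul_assoc, mul_assoc]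
  congr 2
  rw [← lintegral_const_mul _ (by fun_prop)]
  refine lintegral_congr fun ω => ?_
  rw [← lintegral_mul_const _ (by fun_prop)]
  refine setLIntegral_congr_fun measurableSet_Ioi fun r (hr : 0 < r) => ?_
  rw [hk r hr, norm_smul, norm_eq_of_mem_sphere, mul_one, Real.norm_eq_abs, sq_abs,
    ENNReal.ofReal_mul (by positivity)]
  ring

/-- The normalization of the radial part of the Gaussian measure. -/
theorem gauss_radial_const (n : ℕ) [NeZero n] : ENNReal.ofReal ((√(2 * Real.pi))⁻¹ ^ n) *
        (volume : Measure (EuclideanSpace ℝ (Fin n))).toSphere univ *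
        (∫⁻ r in Ioi (0 : ℝ), ENNReal.ofReal (r ^ (n - 1) * Real.exp (-r ^ 2 / 2))) = 1 := by
  have := isProbabilityMeasure_unif n (Nat.one_le_iff_ne_zero.2 (NeZero.ne n))
  have h := lintegral_gauss_radial (n := n) (Φ := fun _ => 1) (k := fun _ => 1) measurable_const
    (fun r _ _ => by simp) measurable_const
  simpa using h.symm

theorem lintegral_gauss_comp_dir {F : Sph n → ℝ≥0∞} (hF : Measurable F) :
    ∫⁻ x, F (dir x) ∂gauss (EuclideanSpace ℝ (Fin n)) = ∫⁻ ω, F ω ∂unif n := by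
  rw [lintegral_gauss_radial (k := fun _ => 1) (by fun_prop)
    (fun r hr x => by rw [dir_smul hr, one_mul]) measurable_const]
  simp only [one_mul, gauss_radial_const, dir_sphere]

theorem gauss_map_dir : (gauss (EuclideanSpace ℝ (Fin n))).map dir = unif n :=
  Measure.ext_of_lintegral _ fun F hF => by
    rw [lintegral_map hF measurable_dir, lintegral_gauss_comp_dir hF]

theorem lintegral_radial (q : ℝ) (hq : -1 < q) :
    ∫⁻ r in Ioi (0 : ℝ), ENNReal.ofReal (r ^ q * Real.exp (-r ^ 2 / 2)) =
      ENNReal.ofReal ((1 / 2 : ℝ) ^ (-(q + 1) / 2) * (1 / 2) * Real.Gamma ((q + 1) / 2)) := by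
  have h := integral_rpow_mul_exp_neg_mul_rpow (p := 2) (b := 1 / 2) two_pos hq (by norm_num)
  rw [← h, ofReal_integral_eq_lintegral_ofReal]
  · refine setLIntegral_congr_fun measurableSet_Ioi fun r _ => ?_
    congr 3
    rw [Real.rpow_two]
    ring
  · exact integrableOn_rpow_mul_exp_neg_mul_rpow hq two_pos (by norm_num)
  · refine (ae_restrict_iff' measurableSet_Ioi).2 (Eventually.of_forall fun r (hr : 0 < r) => ?_)
    positivity

/-- The second negative moment of the norm of a Gaussian vector. -/
theorem lintegral_gauss_inv_norm_sq (hn : 3 ≤ n) :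
    ∫⁻ x, ENNReal.ofReal (‖x‖⁻¹ ^ 2) ∂gauss (EuclideanSpace ℝ (Fin n)) =
      ENNReal.ofReal (1 / ((n : ℝ) - 2)) := by
  have := isProbabilityMeasure_unif n (by omega)
  have hn' : (3 : ℝ) ≤ n := by exact_mod_cast hn
  rw [lintegral_gauss_radial (k := fun r => ENNReal.ofReal (r⁻¹ ^ 2)) (by fun_prop)
    (fun r hr x => by
      rw [← ENNReal.ofReal_mul (by positivity), norm_smul, Real.norm_eq_abs, abs_of_pos hr,
        mul_inv, mul_pow]) (by fun_prop)]
  have h1 : ∫⁻ r in Ioi (0 : ℝ), ENNReal.ofReal (r⁻¹ ^ 2) *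
      ENNReal.ofReal (r ^ (n - 1) * Real.exp (-r ^ 2 / 2)) =
      ENNReal.ofReal (1 / ((n : ℝ) - 2)) *
        ∫⁻ r in Ioi (0 : ℝ), ENNReal.ofReal (r ^ (n - 1) * Real.exp (-r ^ 2 / 2)) := by
    have e1 : ∫⁻ r in Ioi (0 : ℝ), ENNReal.ofReal (r⁻¹ ^ 2) *
      ENNReal.ofReal (r ^ (n - 1) * Real.exp (-r ^ 2 / 2)) =
      ∫⁻ r in Ioi (0 : ℝ), ENNReal.ofReal (r ^ ((n : ℝ) - 3) * Real.exp (-r ^ 2 / 2)) := by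
      refine setLIntegral_congr_fun measurableSet_Ioi fun r (hr : 0 < r) => ?_
      rw [← ENNReal.ofReal_mul (by positivity), ← mul_assoc]
      obtain ⟨k, rfl⟩ := Nat.exists_eq_add_of_le hn
      have e : ((3 + k : ℕ) : ℝ) - 3 = (k : ℝ) := by push_cast; ring
      have e' : 3 + k - 1 = k + 2 := by omega
      rw [e, e', Real.rpow_natCast]
      congr 2
      field_simp
      ring
    have e2 : ∫⁻ r in Ioi (0 : ℝ), ENNReal.ofReal (r ^ (n - 1) * Real.exp (-r ^ 2 / 2)) =
      ∫⁻ r in Ioi (0 : ℝ), ENNReal.ofReal (r ^ ((n : ℝ) - 1) * Real.exp (-r ^ 2 / 2)) := by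
      refine setLIntegral_congr_fun measurableSet_Ioi fun r (hr : 0 < r) => ?_
      rw [← Real.rpow_natCast, Nat.cast_sub (by omega), Nat.cast_one]
    -- The radial moments of orders n-3 and n-1 differ by one step of Γ(s+1) = sΓ(s) with s =
    -- (n-2)/2. The lower one converges because n-3 > -1.
    rw [e1, e2, lintegral_radial _ (by linarith), lintegral_radial _ (by linarith),
      ← ENNReal.ofReal_mul (by apply one_div_nonneg.2; linarith)]
    congr 1
    have e3 : ((n : ℝ) - 1 + 1) / 2 = ((n : ℝ) - 3 + 1) / 2 + 1 := by ring
    have e4 : -((n : ℝ) - 1 + 1) / 2 = -((n : ℝ) - 3 + 1) / 2 - 1 := by ring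
    rw [e3, e4, Real.Gamma_add_one (by linarith), Real.rpow_sub_one (by norm_num)]
    have : (n : ℝ) - 2 ≠ 0 := by linarith
    field_simp
    ring
  rw [h1, mul_left_comm, gauss_radial_const]
  simp

end radial

theorem lintegral_gauss_comp_isometry {E : Type*} [NormedAddCommGroup E] [InnerProductSpace ℝ E]
    [FiniteDimensional ℝ E] [MeasurableSpace E] [BorelSpace E] (L : E ≃ₗᵢ[ℝ] E) {Φ : E → ℝ≥0∞}
    (hΦ : Measurable Φ) : ∫⁻ x, Φ (L x) ∂gauss E = ∫⁻ x, Φ x ∂gauss E := by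
  have hL : Measurable L := L.continuous.measurable
  rw [lintegral_gauss (Φ := fun x => Φ (L x)) (hΦ.comp hL), lintegral_gauss hΦ]
  congr 1
  rw [← L.measurePreserving.lintegral_comp (f := fun x => Φ x *
    ENNReal.ofReal (Real.exp (-‖x‖ ^ 2 / 2))) (by fun_prop)]
  simp

/-- The reduction for homogeneous functions with F = G = |x|⁻¹, which equals 1 on the sphere,
expresses the mass as the mean of 1/(|X||Z|). -/
theorem mixingMeasure_univ {n : ℕ} (hn : 2 ≤ n) : mixingMeasure n univ =
    ∫⁻ p, ENNReal.ofReal (‖p.1‖⁻¹ * ‖p.2‖⁻¹) ∂gaussMix (EuclideanSpace ℝ (Fin n)) := by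
  have hF' : ∀ r : ℝ, 0 < r → ∀ x : EuclideanSpace ℝ (Fin n),
      ENNReal.ofReal ‖r • x‖⁻¹ = ENNReal.ofReal r⁻¹ * ENNReal.ofReal ‖x‖⁻¹ := by
    intro r hr x
    rw [← ENNReal.ofReal_mul (by positivity), norm_smul, Real.norm_eq_abs, abs_of_pos hr, mul_inv]
  simp_rw [fun p : EuclideanSpace ℝ (Fin n) × EuclideanSpace ℝ (Fin n) =>
    ENNReal.ofReal_mul (p := ‖p.1‖⁻¹) (q := ‖p.2‖⁻¹) (by positivity)]
  rw [lintegral_gaussMix_of_homogeneous (F := fun x => ENNReal.ofReal ‖x‖⁻¹)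
    (G := fun x => ENNReal.ofReal ‖x‖⁻¹) hn (by fun_prop) (by fun_prop) hF' hF']
  simp

/-! ### Rotation invariance and the upper bound for the constant -/

section sphere

variable {n : ℕ} [NeZero n]

/-- Rotation invariance is inherited from the Gaussian measure: both sides become Gaussian integrals
of functions of the direction, and the reflection exchanging ω and ω' is an isometry. -/
theorem lintegral_unif_inner {φ : ℝ → ℝ≥0∞} (hφ : Measurable φ) (ω ω' : Sph n) :
    ∫⁻ ξ : Sph n, φ ⟪(ω : EuclideanSpace ℝ (Fin n)), ξ⟫ ∂unif n =
      ∫⁻ ξ : Sph n, φ ⟪(ω' : EuclideanSpace ℝ (Fin n)), ξ⟫ ∂unif n := by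
  have key : ∀ ω : Sph n, ∫⁻ ξ : Sph n, φ ⟪(ω : EuclideanSpace ℝ (Fin n)), ξ⟫ ∂unif n =
      ∫⁻ x, φ ⟪(ω : EuclideanSpace ℝ (Fin n)), ‖x‖⁻¹ • x⟫
        ∂gauss (EuclideanSpace ℝ (Fin n)) := by
    intro ω
    rw [lintegral_gauss_radial (k := fun _ => 1) (by fun_prop) (fun r hr x => ?_)
      measurable_const]
    · simp only [one_mul, gauss_radial_const, norm_eq_of_mem_sphere, inv_one, one_smul]
    · rw [one_mul, norm_smul, Real.norm_eq_abs, abs_of_pos hr, smul_smul]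
      congr 3
      field_simp
  rw [key, key]
  set L := (ℝ ∙ ((ω : EuclideanSpace ℝ (Fin n)) - ω'))ᗮ.reflection
  have hL : L ω = ω' := Submodule.reflection_sub (by simp)
  rw [← lintegral_gauss_comp_isometry L (Φ := fun x =>
    φ ⟪(ω' : EuclideanSpace ℝ (Fin n)), ‖x‖⁻¹ • x⟫) (by fun_prop)]
  refine lintegral_congr fun x => ?_
  rw [← hL, LinearIsometryEquiv.norm_map, ← map_smul, LinearIsometryEquiv.inner_map_map]

theorem mixingMeasure_map_swap : (mixingMeasure n).map Prod.swap = mixingMeasure n := by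
  have := isProbabilityMeasure_unif n (Nat.one_le_iff_ne_zero.2 (NeZero.ne n))
  have hmd : Measurable fun p : Sph n × Sph n => mixingDensity n
      ⟪(p.1 : EuclideanSpace ℝ (Fin n)), (p.2 : EuclideanSpace ℝ (Fin n))⟫ := by fun_prop
  refine Measure.ext_of_lintegral _ fun Φ hΦ => ?_
  rw [lintegral_map hΦ measurable_swap, mixingMeasure,
    lintegral_withDensity_eq_lintegral_mul _ hmd (by fun_prop),
    lintegral_withDensity_eq_lintegral_mul _ hmd hΦ, ← lintegral_prod_swap]
  refine lintegral_congr fun p => ?_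
  simp [real_inner_comm]

/-- The integral of ψₙ(⟨ω, ξ⟩) over ξ does not depend on ω, by rotation invariance. The marginal is
therefore a multiple of σ, and the test function 1 identifies the multiple as the total mass. -/
theorem mixingMeasure_map_fst :
    (mixingMeasure n).map Prod.fst = mixingMeasure n univ • unif n := by
  have := isProbabilityMeasure_unif n (Nat.one_le_iff_ne_zero.2 (NeZero.ne n))
  have hmd : Measurable fun p : Sph n × Sph n => mixingDensity n
      ⟪(p.1 : EuclideanSpace ℝ (Fin n)), (p.2 : EuclideanSpace ℝ (Fin n))⟫ := by fun_prop
  have key : ∀ F : Sph n → ℝ≥0∞, Measurable F → ∫⁻ p, F p.1 ∂mixingMeasure n =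
      (∫⁻ ξ : Sph n, mixingDensity n ⟪((dir 0 : Sph n) : EuclideanSpace ℝ (Fin n)), ξ⟫ ∂unif n) *
        ∫⁻ ω, F ω ∂unif n := by
    intro F hF
    rw [mixingMeasure, lintegral_withDensity_eq_lintegral_mul _ hmd (by fun_prop),
      lintegral_prod _ (by fun_prop), ← lintegral_const_mul _ hF]
    refine lintegral_congr fun ω => ?_
    simp only [Pi.mul_apply]
    rw [lintegral_mul_const _ (by fun_prop),
      lintegral_unif_inner (measurable_mixingDensity n) ω (dir 0)]
  refine Measure.ext_of_lintegral _ fun F hF => ?_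
  rw [lintegral_map hF measurable_fst, key F hF, lintegral_smul_measure, smul_eq_mul]
  congr 1
  have h1 := key (fun _ => 1) measurable_const
  simpa using h1.symm

theorem mixingMeasure_map_snd :
    (mixingMeasure n).map Prod.snd = mixingMeasure n univ • unif n := by
  rw [← mixingMeasure_map_fst]
  conv_rhs => rw [← mixingMeasure_map_swap, Measure.map_map measurable_fst measurable_swap]
  rfl

/-- AM-GM bounds 1/(|X||Z|) by the mean of |X|⁻² and |Z|⁻², each of expectation 1/(n-2) since both
marginals are standard Gaussian. Equality would require |X| = |Z|, an event of probability zero. -/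
theorem mixingMeasure_univ_lt (hn : 3 ≤ n) :
    mixingMeasure n univ < ENNReal.ofReal (1 / ((n : ℝ) - 2)) := by
  have : Nontrivial (Fin n) := Fin.nontrivial_iff_two_le.2 (by omega)
  have hle : ∀ p : EuclideanSpace ℝ (Fin n) × EuclideanSpace ℝ (Fin n),
      ‖p.1‖⁻¹ * ‖p.2‖⁻¹ ≤ 1 / 2 * ‖p.1‖⁻¹ ^ 2 + 1 / 2 * ‖p.2‖⁻¹ ^ 2 :=
    fun p => by nlinarith [sq_nonneg (‖p.1‖⁻¹ - ‖p.2‖⁻¹)]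
  have hg : ∫⁻ p : EuclideanSpace ℝ (Fin n) × EuclideanSpace ℝ (Fin n),
        ENNReal.ofReal (1 / 2 * ‖p.1‖⁻¹ ^ 2 + 1 / 2 * ‖p.2‖⁻¹ ^ 2)
      ∂gaussMix (EuclideanSpace ℝ (Fin n)) =
      ENNReal.ofReal (1 / ((n : ℝ) - 2)) := by
    have e1 : ∫⁻ p : EuclideanSpace ℝ (Fin n) × EuclideanSpace ℝ (Fin n),
        ENNReal.ofReal (‖p.1‖⁻¹ ^ 2)
        ∂gaussMix (EuclideanSpace ℝ (Fin n)) =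
        ENNReal.ofReal (1 / ((n : ℝ) - 2)) := by
      rw [← lintegral_gauss_inv_norm_sq hn, ← gaussMix_map_fst,
        lintegral_map (by fun_prop) measurable_fst]
    have e2 : ∫⁻ p : EuclideanSpace ℝ (Fin n) × EuclideanSpace ℝ (Fin n),
        ENNReal.ofReal (‖p.2‖⁻¹ ^ 2)
        ∂gaussMix (EuclideanSpace ℝ (Fin n)) =
        ENNReal.ofReal (1 / ((n : ℝ) - 2)) := by
      rw [← lintegral_gauss_inv_norm_sq hn, ← gaussMix_map_snd,
        lintegral_map (by fun_prop) measurable_snd]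
    have e3 : ∀ p : EuclideanSpace ℝ (Fin n) × EuclideanSpace ℝ (Fin n),
        ENNReal.ofReal (1 / 2 * ‖p.1‖⁻¹ ^ 2 + 1 / 2 * ‖p.2‖⁻¹ ^ 2) =
        ENNReal.ofReal (1 / 2) * ENNReal.ofReal (‖p.1‖⁻¹ ^ 2) +
        ENNReal.ofReal (1 / 2) * ENNReal.ofReal (‖p.2‖⁻¹ ^ 2) := fun p => by
      rw [ENNReal.ofReal_add (by positivity) (by positivity), ENNReal.ofReal_mul (by norm_num),
        ENNReal.ofReal_mul (by norm_num)]
    simp_rw [e3]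
    rw [lintegral_add_left (by fun_prop), lintegral_const_mul _ (by fun_prop),
      lintegral_const_mul _ (by fun_prop), e1, e2, ← add_mul,
      ← ENNReal.ofReal_add (by norm_num) (by norm_num)]
    norm_num
  rw [mixingMeasure_univ (by omega), ← hg]
  refine lintegral_strict_mono (IsProbabilityMeasure.ne_zero _) (by fun_prop) ?_ ?_
  · refine ne_top_of_le_ne_top ?_ (lintegral_mono fun p => ENNReal.ofReal_le_ofReal (hle p))
    rw [hg]
    exact ENNReal.ofReal_ne_top
  · filter_upwards [gaussMix_ae_norm_ne] with p hp
    have h1 : ‖p.1‖⁻¹ - ‖p.2‖⁻¹ ≠ 0 := sub_ne_zero.2 fun h => hp (inv_injective h)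
    have h2 : ‖p.1‖⁻¹ * ‖p.2‖⁻¹ < 1 / 2 * ‖p.1‖⁻¹ ^ 2 + 1 / 2 * ‖p.2‖⁻¹ ^ 2 := by
      nlinarith [sq_pos_of_ne_zero h1]
    exact (ENNReal.ofReal_lt_ofReal_iff (lt_of_le_of_lt (by positivity) h2)).2 h2

end sphere

/-! ### Finiteness of the constant, including the planar case -/

theorem lintegral_exp_neg_sq (s : ℝ) (hs : 0 < s) :
    ∫⁻ x : ℝ, ENNReal.ofReal (Real.exp (-(s * x) ^ 2 / 2)) =
      ENNReal.ofReal (√(2 * Real.pi) / s) := by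
  have h := lintegral_exp_neg_mul_sq_norm (E := ℝ) hs
  simp only [Module.finrank_self, pow_one] at h
  rw [← h]
  refine lintegral_congr fun x => ?_
  rw [mul_pow, mul_pow, Real.norm_eq_abs, sq_abs]

/-- Completing the square in s and using t²α² ≤ t bounds the quadratic form below by (1-t)r² + (s -
rtα)². Integrating over the whole plane gives a bound that is uniform in α and integrable in t. -/
theorem quadrantIntegral_two_le {t α : ℝ} (ht : t ∈ Ioo (0 : ℝ) 1) (hα : |α| ≤ 1) :
    quadrantIntegral 2 t α ≤ ENNReal.ofReal (2 * Real.pi * (1 - t) ^ (-(1 / 2) : ℝ)) := by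
  have hs0 : 0 < 1 - t := by linarith [ht.2]
  have hs : 0 < √(1 - t) := Real.sqrt_pos.2 hs0
  have hα' : α ^ 2 ≤ 1 := (sq_le_one_iff_abs_le_one α).2 hα
  unfold quadrantIntegral
  calc _ ≤ ∫⁻ r in Ioi (0 : ℝ), ∫⁻ s in Ioi (0 : ℝ),
        ENNReal.ofReal (Real.exp (-(√(1 - t) * r) ^ 2 / 2)) *
          ENNReal.ofReal (Real.exp (-(1 * (s - r * t * α)) ^ 2 / 2)) := by
        refine lintegral_mono fun r => lintegral_mono fun s => ?_
        rw [← ENNReal.ofReal_mul (Real.exp_pos _).le, ← Real.exp_add]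
        refine ENNReal.ofReal_le_ofReal ?_
        simp only [Nat.sub_self, pow_zero, mul_one]
        refine Real.exp_le_exp.2 ?_
        rw [mul_pow, Real.sq_sqrt hs0.le]
        have : t ^ 2 * α ^ 2 ≤ t := by nlinarith [ht.1, ht.2, sq_nonneg t, sq_nonneg α]
        nlinarith [mul_le_mul_of_nonneg_left this (sq_nonneg r)]
    _ ≤ ∫⁻ r, ∫⁻ s, ENNReal.ofReal (Real.exp (-(√(1 - t) * r) ^ 2 / 2)) *
          ENNReal.ofReal (Real.exp (-(1 * (s - r * t * α)) ^ 2 / 2)) :=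
        (setLIntegral_le_lintegral _ _).trans
          (lintegral_mono fun r => setLIntegral_le_lintegral _ _)
    _ = ENNReal.ofReal (√(2 * Real.pi) / √(1 - t)) * ENNReal.ofReal (√(2 * Real.pi) / 1) := by
        simp_rw [lintegral_const_mul' _ _ ENNReal.ofReal_ne_top]
        have e : ∀ r : ℝ, ∫⁻ s : ℝ, ENNReal.ofReal (Real.exp (-(1 * (s - r * t * α)) ^ 2 / 2)) =
            ∫⁻ s : ℝ, ENNReal.ofReal (Real.exp (-(1 * s) ^ 2 / 2)) := fun r =>
          lintegral_sub_right_eq_self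
            (fun s : ℝ => ENNReal.ofReal (Real.exp (-(1 * s) ^ 2 / 2))) (r * t * α)
        rw [lintegral_congr fun r => by rw [e r]]
        rw [lintegral_mul_const _ (by fun_prop), lintegral_exp_neg_sq _ hs,
          lintegral_exp_neg_sq _ one_pos]
    _ ≤ _ := by
        rw [← ENNReal.ofReal_mul (by positivity), Real.rpow_neg hs0.le, ← Real.sqrt_eq_rpow]
        refine ENNReal.ofReal_le_ofReal (le_of_eq ?_)
        have h : √(2 * Real.pi) ^ 2 = 2 * Real.pi := Real.sq_sqrt (by positivity)
        field_simp
        rw [h]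

theorem integrableOn_one_sub_rpow :
    IntegrableOn (fun t : ℝ => (1 - t) ^ (-(1 / 2) : ℝ)) (Ioo 0 1) := by
  have h := (intervalIntegral.intervalIntegrable_rpow' (a := 0) (b := 1)
    (r := (-(1 / 2) : ℝ)) (by norm_num)).comp_sub_left 1
  simp only [sub_zero, sub_self] at h
  exact (intervalIntegrable_iff_integrableOn_Ioo_of_le zero_le_one).1 h.symm

/-- For n = 2 the AM-GM bound is void, as |X|⁻² has infinite expectation. Instead ψ₂ itself is
bounded on [-1, 1]. -/
theorem mixingMeasure_two_univ_ne_top : mixingMeasure 2 univ ≠ ∞ := by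
  have := isProbabilityMeasure_unif 2 (by norm_num)
  set C : ℝ≥0∞ := ENNReal.ofReal (1 / (2 ^ (2 - 2) * Real.Gamma ((2 : ℕ) / 2) ^ 2)) *
    ∫⁻ t in Ioo (0 : ℝ) 1, ENNReal.ofReal (2 * Real.pi * (1 - t) ^ (-(1 / 2) : ℝ)) with hC
  have hC' : C ≠ ∞ := by
    refine ENNReal.mul_ne_top ENNReal.ofReal_ne_top (ne_of_lt ?_)
    exact (integrableOn_one_sub_rpow.const_mul (2 * Real.pi)).lintegral_lt_top
  have hψ : ∀ α : ℝ, |α| ≤ 1 → mixingDensity 2 α ≤ C := by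
    intro α hα
    rw [mixingDensity_eq, hC]
    refine mul_le_mul_right ?_ _
    refine setLIntegral_mono' measurableSet_Ioo fun t ht => ?_
    simpa using quadrantIntegral_two_le ht hα
  rw [mixingMeasure, withDensity_apply _ MeasurableSet.univ, Measure.restrict_univ]
  refine ne_top_of_le_ne_top hC' ?_
  calc _ ≤ ∫⁻ p : Sph 2 × Sph 2, C ∂((unif 2).prod (unif 2)) := by
        refine lintegral_mono fun p => hψ _ ?_
        refine (abs_real_inner_le_norm _ _).trans (by simp)
    _ = C := by simp

theorem isFiniteMeasure_mixingMeasure {n : ℕ} (hn : 2 ≤ n) :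
    IsFiniteMeasure (mixingMeasure n) := by
  constructor
  rcases hn.eq_or_lt with rfl | h
  · exact mixingMeasure_two_univ_ne_top.lt_top
  · have : NeZero n := ⟨by omega⟩
    exact (mixingMeasure_univ_lt h).trans_le le_top

theorem mixingConst_lt {n : ℕ} (hn : 3 ≤ n) : mixingConst n < 1 / ((n : ℝ) - 2) := by
  have : NeZero n := ⟨by omega⟩
  have hn' : (3 : ℝ) ≤ n := by exact_mod_cast hn
  exact (ENNReal.lt_ofReal_iff_toReal_lt (mixingMeasure_univ_lt hn).ne_top).1
    (mixingMeasure_univ_lt hn)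

/-! ### Factorizations and derivative of the Mehler kernel -/

section kernel

variable {E : Type*} [NormedAddCommGroup E] [InnerProductSpace ℝ E]

theorem mehlerKernel_eq {t : ℝ} (ht : t ∈ Ioo (0 : ℝ) 1) (x z : E) : mehlerKernel t x z =
    Real.exp (-‖√(1 - t ^ 2) • z‖ ^ 2 / 2) * Real.exp (-‖x - t • z‖ ^ 2 / 2) := by
  rw [mehlerKernel, ← Real.exp_add, norm_smul, mul_pow, Real.norm_eq_abs, sq_abs,
    Real.sq_sqrt (by nlinarith [ht.1, ht.2]), norm_sub_sq_real, norm_smul,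
    inner_smul_right, mul_pow, Real.norm_eq_abs, sq_abs]
  congr 1
  ring

theorem mehlerKernel_eq' {t : ℝ} (ht : t ∈ Ioo (0 : ℝ) 1) (x z : E) : mehlerKernel t x z =
    Real.exp (-‖√(1 - t ^ 2) • x‖ ^ 2 / 2) * Real.exp (-‖z - t • x‖ ^ 2 / 2) := by
  rw [← mehlerKernel_eq ht, mehlerKernel, mehlerKernel, real_inner_comm, add_comm (‖x‖ ^ 2)]

theorem mehlerKernel_pos (t : ℝ) (x z : E) : 0 < mehlerKernel t x z := Real.exp_pos _

theorem hasFDerivAt_mehlerKernel (t : ℝ) (x z : E) :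
    HasFDerivAt (fun x => mehlerKernel t x z)
      (-(mehlerKernel t x z) • innerSL ℝ (x - t • z)) x := by
  have h1 : HasFDerivAt (fun x : E => ‖x‖ ^ 2) (2 • innerSL ℝ x) x :=
    (hasStrictFDerivAt_norm_sq x).hasFDerivAt
  have h2 : HasFDerivAt (fun x : E => ⟪x, z⟫) (innerSL ℝ z) x := by
    have := (innerSL ℝ z).hasFDerivAt (x := x)
    refine this.congr_of_eventuallyEq (Eventually.of_forall fun y => ?_)
    simp [real_inner_comm]
  have h3 := ((((h1.add_const (‖z‖ ^ 2)).sub (h2.const_mul (2 * t))).neg).mul_const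
    ((2 : ℝ)⁻¹)).exp
  refine (h3.congr_fderiv ?_).congr_of_eventuallyEq (Eventually.of_forall fun y => ?_)
  · ext w
    simp [mehlerKernel, div_eq_mul_inv]
    ring
  · simp [mehlerKernel, div_eq_mul_inv]

end kernel

/-! ### Gaussian covariance inequality -/

section covariance

variable {E : Type*} [NormedAddCommGroup E] [InnerProductSpace ℝ E] [FiniteDimensional ℝ E]
  [MeasurableSpace E] [BorelSpace E]

theorem integrable_exp_neg_sq_norm_div_two :
    Integrable fun x : E => Real.exp (-‖x‖ ^ 2 / 2) :=
  (integrable_exp_neg_mul_sq_norm (E := E) (b := 1 / 2) (by norm_num)).congr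
    (Eventually.of_forall fun x => by simp only; congr 1; ring)

theorem integrable_norm_mul_exp_neg_sq_norm_div_two :
    Integrable fun x : E => ‖x‖ * Real.exp (-‖x‖ ^ 2 / 2) := by
  refine ((integrable_exp_neg_mul_sq_norm (E := E) (b := 1 / 4) (by norm_num)).const_mul 4).mono'
    (by fun_prop) (Eventually.of_forall fun x => ?_)
  rw [Real.norm_of_nonneg (by positivity)]
  have h1 : ‖x‖ ≤ 4 * Real.exp (‖x‖ ^ 2 / 4) := by
    nlinarith [Real.add_one_le_exp (‖x‖ ^ 2 / 4), sq_nonneg (‖x‖ - 1)]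
  calc ‖x‖ * Real.exp (-‖x‖ ^ 2 / 2) ≤ 4 * Real.exp (‖x‖ ^ 2 / 4) * Real.exp (-‖x‖ ^ 2 / 2) := by
        gcongr
    _ = 4 * Real.exp (-(1 / 4) * ‖x‖ ^ 2) := by
        rw [mul_assoc, ← Real.exp_add]; congr 2; ring

theorem integral_gauss (f : E → ℝ) : ∫ x, f x ∂gauss E =
    (√(2 * Real.pi))⁻¹ ^ Module.finrank ℝ E * ∫ x, Real.exp (-‖x‖ ^ 2 / 2) * f x := by
  rw [gauss, integral_withDensity_eq_integral_toReal_smul (by fun_prop) (by simp),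
    ← integral_const_mul]
  refine integral_congr_ae (Eventually.of_forall fun x => ?_)
  simp only
  rw [ENNReal.toReal_ofReal (by positivity), smul_eq_mul, mul_assoc]

theorem integrable_norm_gauss : Integrable (fun x : E => ‖x‖) (gauss E) := by
  rw [gauss, integrable_withDensity_iff (by fun_prop) (by simp)]
  refine (integrable_norm_mul_exp_neg_sq_norm_div_two.const_mul
    ((√(2 * Real.pi))⁻¹ ^ Module.finrank ℝ E)).congr (Eventually.of_forall fun x => ?_)
  simp only
  rw [ENNReal.toReal_ofReal (by positivity)]
  ring

theorem integrable_norm_mul_mehlerKernel {t : ℝ} (ht : t ∈ Ioo (0 : ℝ) 1) (z : E) :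
    Integrable fun x : E => ‖x - t • z‖ * mehlerKernel t x z := by
  simp_rw [mehlerKernel_eq ht, mul_left_comm _ (Real.exp (-‖√(1 - t ^ 2) • z‖ ^ 2 / 2))]
  exact (integrable_norm_mul_exp_neg_sq_norm_div_two.comp_sub_right (t • z)).const_mul _

theorem integrable_mehlerKernel {t : ℝ} (ht : t ∈ Ioo (0 : ℝ) 1) (z : E) :
    Integrable fun x : E => mehlerKernel t x z := by
  simp_rw [mehlerKernel_eq ht]
  exact (integrable_exp_neg_sq_norm_div_two.comp_sub_right (t • z)).const_mul _

theorem integrable_norm_mul_mehlerKernel_prod {t : ℝ} (ht : t ∈ Ioo (0 : ℝ) 1) :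
    Integrable (fun p : E × E => ‖p.1 - t • p.2‖ * mehlerKernel t p.1 p.2)
      (volume.prod volume) := by
  have hm : Measurable fun p : E × E => ‖p.1 - t • p.2‖ * mehlerKernel t p.1 p.2 := by fun_prop
  refine (integrable_prod_iff' hm.aestronglyMeasurable).2 ⟨Eventually.of_forall fun z =>
    integrable_norm_mul_mehlerKernel ht z, ?_⟩
  have hs : 0 < √(1 - t ^ 2) := Real.sqrt_pos.2 (by nlinarith [ht.1, ht.2])
  have h : ∀ z : E, ∫ x : E, ‖‖x - t • z‖ * mehlerKernel t x z‖ =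
      Real.exp (-‖√(1 - t ^ 2) • z‖ ^ 2 / 2) * ∫ x : E, ‖x‖ * Real.exp (-‖x‖ ^ 2 / 2) := by
    intro z
    rw [← integral_sub_right_eq_self (fun x : E => ‖x‖ * Real.exp (-‖x‖ ^ 2 / 2)) (t • z),
      ← integral_const_mul]
    refine integral_congr_ae (Eventually.of_forall fun x => ?_)
    simp only
    rw [norm_mul, norm_norm, Real.norm_of_nonneg (mehlerKernel_pos _ _ _).le, mehlerKernel_eq ht]
    ring
  simp_rw [h]
  exact (integrable_exp_neg_sq_norm_div_two.comp_smul hs.ne').mul_const _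

variable {u v : E → ℝ} {gu gv : E → E} {M C C' : ℝ}

/-- The x-derivative of the kernel in direction w is -⟨w, x - tz⟩ times the kernel. Boundedness of u
and its gradient supplies the integrability that excludes boundary terms. -/
theorem integral_by_parts_mehlerKernel (hu : ∀ x, HasGradientAt u (gu x) x)
    (hgu : Measurable gu) (huM : ∀ x, |u x| ≤ M) (hguC : ∀ x, ‖gu x‖ ≤ C)
    {t s : ℝ} (ht : t ∈ Ioo (0 : ℝ) 1) (z w : E) :
    ∫ x, u (s • x) * ⟪w, x - t • z⟫ * mehlerKernel t x z =
      s * ∫ x, ⟪gu (s • x), w⟫ * mehlerKernel t x z := by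
  have hud : Differentiable ℝ u := fun x => (hu x).differentiableAt
  have hum : Measurable u := hud.continuous.measurable
  have hC : 0 ≤ C := (norm_nonneg _).trans (hguC 0)
  have hM : 0 ≤ M := (abs_nonneg _).trans (huM 0)
  have hsd : ∀ x, HasFDerivAt (fun x => u (s • x)) (s • innerSL ℝ (gu (s • x))) x := by
    intro x
    have h1 : HasFDerivAt u (innerSL ℝ (gu (s • x))) (s • x) := (hu (s • x)).hasFDerivAt
    have h2 := h1.comp x ((hasFDerivAt_id x).const_smul s)
    refine h2.congr_fderiv ?_
    ext y
    simp
  have e1 : ∀ x, fderiv ℝ (fun x => u (s • x)) x w = s * ⟪gu (s • x), w⟫ := fun x => by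
    rw [(hsd x).fderiv]; simp
  have e2 : ∀ x, fderiv ℝ (fun x => mehlerKernel t x z) x w =
      -(⟪w, x - t • z⟫ * mehlerKernel t x z) := fun x => by
    rw [(hasFDerivAt_mehlerKernel t x z).fderiv]
    simp [inner_sub_right, inner_smul_right, real_inner_comm w]
    ring
  have key := integral_mul_fderiv_eq_neg_fderiv_mul_of_integrable (μ := (volume : Measure E))
    (f := fun x => u (s • x)) (g := fun x => mehlerKernel t x z) (v := w) ?_ ?_ ?_
    (fun x _ => (hsd x).differentiableAt)
    (fun x _ => (hasFDerivAt_mehlerKernel t x z).differentiableAt)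
  · simp_rw [e1, e2, mul_neg, integral_neg, neg_inj, ← mul_assoc] at key
    rw [key, ← integral_const_mul]
    simp_rw [mul_assoc]
  · simp_rw [e1]
    refine ((integrable_mehlerKernel ht z).const_mul (|s| * (C * ‖w‖))).mono' (by fun_prop)
      (Eventually.of_forall fun x => ?_)
    rw [norm_mul, norm_mul, Real.norm_of_nonneg (mehlerKernel_pos _ _ _).le, Real.norm_eq_abs,
      Real.norm_eq_abs]
    have := (abs_real_inner_le_norm (gu (s • x)) w).trans
      (mul_le_mul_of_nonneg_right (hguC _) (norm_nonneg w))
    have := (mehlerKernel_pos t x z).le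
    gcongr
  · simp_rw [e2]
    refine ((integrable_norm_mul_mehlerKernel ht z).const_mul (M * ‖w‖)).mono' (by fun_prop)
      (Eventually.of_forall fun x => ?_)
    rw [norm_mul, norm_neg, norm_mul, Real.norm_of_nonneg (mehlerKernel_pos _ _ _).le,
      Real.norm_eq_abs, Real.norm_eq_abs, mul_assoc, ← mul_assoc ‖w‖]
    have := (mehlerKernel_pos t x z).le
    exact mul_le_mul (huM _) (mul_le_mul_of_nonneg_right (abs_real_inner_le_norm _ _) this)
      (by positivity) hM
  · refine ((integrable_mehlerKernel ht z).const_mul M).mono' (by fun_prop)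
      (Eventually.of_forall fun x => ?_)
    rw [norm_mul, Real.norm_of_nonneg (mehlerKernel_pos _ _ _).le, Real.norm_eq_abs]
    exact mul_le_mul_of_nonneg_right (huM _) (mehlerKernel_pos t x z).le

end covariance

/-- The velocity of the path t ↦ tx + √(1-t²)y may blow up as t → 1, but only like (1-t)^{-1/2}.
This integrable majorant justifies both the fundamental theorem of calculus and Fubini's theorem. -/
theorem norm_inner_interpolation_le {E : Type*} [NormedAddCommGroup E]
    [InnerProductSpace ℝ E] {gv : E → E} {C' : ℝ} (hgvC : ∀ x, ‖gv x‖ ≤ C')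
    {t : ℝ} (ht : t ∈ Ioo (0 : ℝ) 1)
    (x y : E) : ‖⟪gv (t • x + √(1 - t ^ 2) • y), x - (t / √(1 - t ^ 2)) • y⟫‖ ≤
      C' * (‖x‖ + ‖y‖ * (1 - t) ^ (-(1 / 2) : ℝ)) := by
  have hs0 : 0 < 1 - t := by linarith [ht.2]
  have h1 : t / √(1 - t ^ 2) ≤ (1 - t) ^ (-(1 / 2) : ℝ) := by
    rw [Real.rpow_neg hs0.le, ← Real.sqrt_eq_rpow, ← one_div]
    refine div_le_div₀ zero_le_one ht.2.le (Real.sqrt_pos.2 hs0) (Real.sqrt_le_sqrt ?_)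
    nlinarith [ht.1, ht.2]
  refine (norm_inner_le_norm _ _).trans (mul_le_mul (hgvC _) ?_ (norm_nonneg _)
    ((norm_nonneg _).trans (hgvC 0)))
  refine (norm_sub_le _ _).trans (add_le_add_right ?_ _)
  rw [norm_smul, Real.norm_of_nonneg (div_nonneg ht.1.le (Real.sqrt_nonneg _)), mul_comm]
  exact mul_le_mul_of_nonneg_left h1 (norm_nonneg _)

section covariance

variable {E : Type*} [NormedAddCommGroup E] [InnerProductSpace ℝ E] [FiniteDimensional ℝ E]
  [MeasurableSpace E] [BorelSpace E] {u v : E → ℝ} {gu gv : E → E} {M C C' : ℝ}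

theorem integrable_norm_fst_snd_gauss (a b : ℝ) :
    Integrable (fun p : E × E => a * ‖p.1‖ + b * ‖p.2‖) ((gauss E).prod (gauss E)) :=
  (((integrable_norm_gauss (E := E)).comp_fst (gauss E)).const_mul a).add
    (((integrable_norm_gauss (E := E)).comp_snd (gauss E)).const_mul b)

/-- The derivative along the interpolation `t x + √(1 - t²) y`, integrated over independent
Gaussian vectors. -/
theorem integral_interpolation (hu : ∀ x, HasGradientAt u (gu x) x)
    (hgu : Measurable gu) (huM : ∀ x, |u x| ≤ M) (hguC : ∀ x, ‖gu x‖ ≤ C)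
    (hgv : Measurable gv) (hgvC : ∀ x, ‖gv x‖ ≤ C') {t : ℝ} (ht : t ∈ Ioo (0 : ℝ) 1) :
    ∫ p, u p.1 * ⟪gv (t • p.1 + √(1 - t ^ 2) • p.2), p.1 - (t / √(1 - t ^ 2)) • p.2⟫
      ∂((gauss E).prod (gauss E)) =
    (2 * Real.pi)⁻¹ ^ Module.finrank ℝ E * (√(1 - t ^ 2) ^ Module.finrank ℝ E *
      ∫ z : E, ∫ x : E, ⟪gu (√(1 - t ^ 2) • x), gv (√(1 - t ^ 2) • z)⟫ * mehlerKernel t x z) := by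
  have hs0 : 0 < 1 - t ^ 2 := by nlinarith [ht.1, ht.2]
  have hs : 0 < √(1 - t ^ 2) := Real.sqrt_pos.2 hs0
  have hs2 : √(1 - t ^ 2) ^ 2 = 1 - t ^ 2 := Real.sq_sqrt hs0.le
  set s := √(1 - t ^ 2) with hsdef
  have hud : Differentiable ℝ u := fun x => (hu x).differentiableAt
  have hum : Measurable u := hud.continuous.measurable
  have hC' : 0 ≤ C' := (norm_nonneg _).trans (hgvC 0)
  have hM : 0 ≤ M := (abs_nonneg _).trans (huM 0)
  have hint : Integrable (fun p : E × E => u p.1 * ⟪gv (t • p.1 + s • p.2),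
      p.1 - (t / s) • p.2⟫) ((gauss E).prod (gauss E)) := by
    refine (integrable_norm_fst_snd_gauss (M * C') (M * C' * (t / s))).mono'
      (Measurable.aestronglyMeasurable (by fun_prop)) (Eventually.of_forall fun p => ?_)
    rw [norm_mul, Real.norm_eq_abs, Real.norm_eq_abs]
    have h1 : ‖p.1 - (t / s) • p.2‖ ≤ ‖p.1‖ + (t / s) * ‖p.2‖ := by
      refine (norm_sub_le _ _).trans ?_
      rw [norm_smul, Real.norm_of_nonneg (div_nonneg ht.1.le hs.le)]
    calc _ ≤ M * (C' * (‖p.1‖ + (t / s) * ‖p.2‖)) := by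
          refine mul_le_mul (huM _) ((abs_real_inner_le_norm _ _).trans ?_) (abs_nonneg _) hM
          exact mul_le_mul (hgvC _) h1 (norm_nonneg _) hC'
      _ = _ := by ring
  have hprod : Integrable (fun p : E × E => u (s • p.1) *
      ⟪gv (s • p.2), p.1 - t • p.2⟫ * mehlerKernel t p.1 p.2) (volume.prod volume) := by
    refine ((integrable_norm_mul_mehlerKernel_prod ht).const_mul (M * C')).mono'
      (Measurable.aestronglyMeasurable (by fun_prop)) (Eventually.of_forall fun p => ?_)
    rw [norm_mul, norm_mul, Real.norm_of_nonneg (mehlerKernel_pos _ _ _).le, Real.norm_eq_abs,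
      Real.norm_eq_abs, ← mul_assoc, mul_assoc M]
    refine mul_le_mul_of_nonneg_right ?_ (mehlerKernel_pos _ _ _).le
    exact mul_le_mul (huM _) ((abs_real_inner_le_norm _ _).trans
      (mul_le_mul_of_nonneg_right (hgvC _) (norm_nonneg _))) (abs_nonneg _) hM
  have hκ : (√(2 * Real.pi))⁻¹ ^ Module.finrank ℝ E * (√(2 * Real.pi))⁻¹ ^ Module.finrank ℝ E =
      (2 * Real.pi)⁻¹ ^ Module.finrank ℝ E := by
    rw [← mul_pow, ← mul_inv, Real.mul_self_sqrt (by positivity)]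
  rw [integral_prod _ hint, integral_gauss]
  simp_rw [integral_gauss]
  have hscale : ∀ Ψ : E → ℝ, ∫ x, Ψ x = s ^ Module.finrank ℝ E * ∫ x, Ψ (s • x) := by
    intro Ψ
    rw [Measure.integral_comp_smul, abs_of_pos (by positivity), smul_eq_mul, ← mul_assoc,
      mul_inv_cancel₀ (by positivity), one_mul]
  rw [hscale]
  -- With the first variable rescaled to sx, substitute y = z - tx: the path point becomes sz, its
  -- velocity s⁻¹(x - tz), and the two Gaussian weights multiply to the Mehler kernel.
  have e1 : ∀ x : E, Real.exp (-‖s • x‖ ^ 2 / 2) * ((√(2 * Real.pi))⁻¹ ^ Module.finrank ℝ E *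
      ∫ y, Real.exp (-‖y‖ ^ 2 / 2) * (u (s • x) * ⟪gv (t • s • x + s • y),
        s • x - (t / s) • y⟫)) = (√(2 * Real.pi))⁻¹ ^ Module.finrank ℝ E * ∫ z, s⁻¹ * (u (s • x) *
      ⟪gv (s • z), x - t • z⟫ * mehlerKernel t x z) := by
    intro x
    rw [mul_left_comm, ← integral_const_mul, ← integral_sub_right_eq_self _ (t • x)]
    congr 1
    refine integral_congr_ae (Eventually.of_forall fun z => ?_)
    simp only
    have a1 : t • s • x + s • (z - t • x) = s • z := by
      rw [smul_sub, smul_comm t s x]; abel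
    have a2 : s • x - (t / s) • (z - t • x) = s⁻¹ • (x - t • z) := by
      have b1 : s • x = (s⁻¹ * (1 - t ^ 2)) • x := by
        rw [← hs2]; congr 1; field_simp
      rw [b1]
      match_scalars
      · field_simp; ring
      · field_simp
    rw [a1, a2, inner_smul_right, mehlerKernel_eq' ht]
    ring
  simp_rw [e1]
  rw [integral_const_mul]
  simp_rw [integral_const_mul]
  rw [integral_integral_swap hprod]
  -- Integration by parts in x for fixed z, in the direction gv(sz). The factor s it produces
  -- cancels s⁻¹.
  simp_rw [integral_by_parts_mehlerKernel hu hgu huM hguC ht]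
  rw [integral_const_mul, ← hκ]
  field_simp

/-- The derivative of the interpolation `v (t x + √(1 - t²) y)` is integrable and integrates to
the increment of `v`. -/
theorem integral_deriv_interpolation (hv : ∀ x, HasGradientAt v (gv x) x)
    (hgv : Measurable gv) (hgvC : ∀ x, ‖gv x‖ ≤ C') (x y : E) :
    ∫ t in Ioo (0 : ℝ) 1, ⟪gv (t • x + √(1 - t ^ 2) • y), x - (t / √(1 - t ^ 2)) • y⟫ =
      v x - v y := by
  have hd : ∀ t ∈ Ioo (0 : ℝ) 1, HasDerivAt (fun t : ℝ => v (t • x + √(1 - t ^ 2) • y))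
      ⟪gv (t • x + √(1 - t ^ 2) • y), x - (t / √(1 - t ^ 2)) • y⟫ t := by
    intro t ht
    have hs0 : 1 - t ^ 2 ≠ 0 := by nlinarith [ht.1, ht.2]
    have h1 : HasDerivAt (fun t : ℝ => √(1 - t ^ 2)) (-(t / √(1 - t ^ 2))) t := by
      have h := (((hasDerivAt_id t).pow 2).const_sub 1).sqrt (by simpa using hs0)
      refine h.congr_deriv ?_
      simp
      ring
    have h2 : HasDerivAt (fun t : ℝ => t • x + √(1 - t ^ 2) • y)
        (x - (t / √(1 - t ^ 2)) • y) t := by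
      refine (((hasDerivAt_id t).smul_const x).add (h1.smul_const y)).congr_deriv ?_
      rw [one_smul, neg_smul, ← sub_eq_add_neg]
    have h3 := ((hv (t • x + √(1 - t ^ 2) • y)).hasFDerivAt).comp_hasDerivAt t h2
    exact h3.congr_deriv (by simp)
  have hvc : Continuous v :=
    (show Differentiable ℝ v from fun x => (hv x).differentiableAt).continuous
  have hint : IntegrableOn (fun t : ℝ =>
      ⟪gv (t • x + √(1 - t ^ 2) • y), x - (t / √(1 - t ^ 2)) • y⟫) (Ioo 0 1) := by
    refine (((integrable_const ‖x‖).add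
      (integrableOn_one_sub_rpow.const_mul ‖y‖)).const_mul C').mono'
      (Measurable.aestronglyMeasurable (by fun_prop))
      ((ae_restrict_iff' measurableSet_Ioo).2 (Eventually.of_forall fun t ht => ?_))
    exact norm_inner_interpolation_le hgvC ht x y
  have hint' : IntervalIntegrable (fun t : ℝ =>
      ⟪gv (t • x + √(1 - t ^ 2) • y), x - (t / √(1 - t ^ 2)) • y⟫) volume 0 1 :=
    (intervalIntegrable_iff_integrableOn_Ioo_of_le zero_le_one).2 hint
  -- The path may fail to be differentiable at t = 1; continuity on [0, 1] and an integrable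
  -- derivative inside suffice.
  have key := intervalIntegral.integral_eq_sub_of_hasDerivAt_of_le zero_le_one
    (Continuous.continuousOn (by fun_prop)) hd hint'
  rw [intervalIntegral.integral_of_le zero_le_one, integral_Ioc_eq_integral_Ioo] at key
  simpa using key

/-- The Gaussian covariance inequality along the correlated pairs. -/
theorem covariance_gauss_le (hu : ∀ x, HasGradientAt u (gu x) x)
    (hgu : Measurable gu) (huM : ∀ x, |u x| ≤ M) (hguC : ∀ x, ‖gu x‖ ≤ C)
    (hv : ∀ x, HasGradientAt v (gv x) x) (hvM : ∀ x, |v x| ≤ M)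
    (hgv : Measurable gv) (hgvC : ∀ x, ‖gv x‖ ≤ C') :
    ‖∫ x, u x * v x ∂gauss E - (∫ x, u x ∂gauss E) * ∫ x, v x ∂gauss E‖ₑ ≤
      ∫⁻ p, ‖gu p.1‖ₑ * ‖gv p.2‖ₑ ∂gaussMix E := by
  have hum : Measurable u :=
    (show Differentiable ℝ u from fun x => (hu x).differentiableAt).continuous.measurable
  have hvm : Measurable v :=
    (show Differentiable ℝ v from fun x => (hv x).differentiableAt).continuous.measurable
  have hC' : 0 ≤ C' := (norm_nonneg _).trans (hgvC 0)
  have hM : 0 ≤ M := (abs_nonneg _).trans (huM 0)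
  -- An independent copy Y represents the product of the means as E u(X)v(Y).
  have hcov : ∫ x, u x * v x ∂gauss E - (∫ x, u x ∂gauss E) * ∫ x, v x ∂gauss E =
      ∫ p, u p.1 * (v p.1 - v p.2) ∂((gauss E).prod (gauss E)) := by
    have hb : ∀ a b : ℝ, |a| ≤ M → |b| ≤ M → ‖a * b‖ ≤ M * M := fun a b ha hb => by
      rw [norm_mul]; exact mul_le_mul ha hb (abs_nonneg _) hM
    have i1 : Integrable (fun p : E × E => u p.1 * v p.1) ((gauss E).prod (gauss E)) :=
      Integrable.of_bound (Measurable.aestronglyMeasurable (by fun_prop)) (M * M)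
        (Eventually.of_forall fun p => hb _ _ (huM _) (hvM _))
    have i2 : Integrable (fun p : E × E => u p.1 * v p.2) ((gauss E).prod (gauss E)) :=
      Integrable.of_bound (Measurable.aestronglyMeasurable (by fun_prop)) (M * M)
        (Eventually.of_forall fun p => hb _ _ (huM _) (hvM _))
    simp_rw [mul_sub]
    rw [integral_sub i1 i2, integral_prod_mul, integral_fun_fst (fun x => u x * v x)]
    simp
  have hswap : ∫ p, u p.1 * (v p.1 - v p.2) ∂((gauss E).prod (gauss E)) =
      ∫ t in Ioo (0 : ℝ) 1, ∫ p, u p.1 * ⟪gv (t • p.1 + √(1 - t ^ 2) • p.2),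
        p.1 - (t / √(1 - t ^ 2)) • p.2⟫ ∂((gauss E).prod (gauss E)) := by
    simp_rw [← integral_deriv_interpolation hv hgv hgvC, ← integral_const_mul]
    refine integral_integral_swap ?_
    have i1 : Integrable (fun q : (E × E) × ℝ => M * (C' * (‖q.1.1‖ * 1 +
        ‖q.1.2‖ * (1 - q.2) ^ (-(1 / 2) : ℝ))))
        (((gauss E).prod (gauss E)).prod (volume.restrict (Ioo 0 1))) := by
      refine Integrable.const_mul (Integrable.const_mul (Integrable.add ?_ ?_) _) _
      · exact (integrable_norm_gauss.comp_fst _).mul_prod (integrable_const _)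
      · exact (integrable_norm_gauss.comp_snd _).mul_prod integrableOn_one_sub_rpow
    refine i1.mono' (Measurable.aestronglyMeasurable (by fun_prop)) ?_
    have hae : ∀ᵐ q ∂(((gauss E).prod (gauss E)).prod (volume.restrict (Ioo (0 : ℝ) 1))),
        q.2 ∈ Ioo (0 : ℝ) 1 :=
      Measure.quasiMeasurePreserving_snd.ae (ae_restrict_mem measurableSet_Ioo)
    filter_upwards [hae] with q hq
    rw [Function.uncurry_def, norm_mul, mul_one]
    refine mul_le_mul (huM _) ?_ (norm_nonneg _) hM
    exact (norm_inner_interpolation_le hgvC hq q.1.1 q.1.2).trans (le_of_eq (by simp))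
  rw [hcov, hswap, lintegral_gaussMix (by fun_prop)]
  refine (enorm_integral_le_lintegral_enorm _).trans ?_
  rw [← lintegral_const_mul' _ _ ENNReal.ofReal_ne_top]
  refine setLIntegral_mono' measurableSet_Ioo fun t ht => ?_
  rw [integral_interpolation hu hgu huM hguC hgv hgvC ht, enorm_mul, enorm_mul,
    Real.enorm_of_nonneg (by positivity), Real.enorm_of_nonneg (by positivity)]
  refine mul_le_mul_right (mul_le_mul_right ?_ _) _
  refine (enorm_integral_le_lintegral_enorm _).trans ?_
  rw [lintegral_lintegral_swap (by fun_prop)]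
  refine lintegral_mono fun z => ?_
  refine (enorm_integral_le_lintegral_enorm _).trans (lintegral_mono fun x => ?_)
  rw [enorm_mul, Real.enorm_of_nonneg (mehlerKernel_pos _ _ _).le]
  refine mul_le_mul_left ?_ _
  rw [← ofReal_norm, ← ofReal_norm, ← ofReal_norm,
    ← ENNReal.ofReal_mul (norm_nonneg _)]
  exact ENNReal.ofReal_le_ofReal (norm_inner_le_norm _ _)

end covariance

/-! ### Spherical gradient through the homogeneous extension -/

section gradient

variable {d : ℕ} {f : Sph (d + 1) → ℝ}

/-- The homogeneous extension of a `C¹` function on the sphere is `C¹` away from the origin. -/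
theorem contDiffOn_comp_dir (hf : ContMDiff (𝓡 d) 𝓘(ℝ, ℝ) 1 f) :
    ContDiffOn ℝ 1 (fun x => f (dir x)) ({0}ᶜ : Set (EuclideanSpace ℝ (Fin (d + 1)))) := by
  have : Fact (Module.finrank ℝ (EuclideanSpace ℝ (Fin (d + 1))) = d + 1) :=
    ⟨finrank_euclideanSpace_fin⟩
  -- The punctured space is treated as an open submanifold, so that x ↦ x/|x| is a C¹ map of
  -- manifolds into the sphere.
  let U : TopologicalSpace.Opens (EuclideanSpace ℝ (Fin (d + 1))) := ⟨{0}ᶜ, isOpen_compl_singleton⟩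
  have hU : ∀ x : U, (x : EuclideanSpace ℝ (Fin (d + 1))) ≠ 0 := fun x => x.2
  have h1 : ContMDiff 𝓘(ℝ, EuclideanSpace ℝ (Fin (d + 1))) 𝓘(ℝ, EuclideanSpace ℝ (Fin (d + 1))) 1
      (fun x : U => ‖(x : EuclideanSpace ℝ (Fin (d + 1)))‖⁻¹ •
        (x : EuclideanSpace ℝ (Fin (d + 1)))) := by
    intro x
    refine (contMDiffAt_subtype_iff (f := fun x : EuclideanSpace ℝ (Fin (d + 1)) =>
      ‖x‖⁻¹ • x)).2 (ContDiffAt.contMDiffAt ?_)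
    exact ((contDiffAt_norm ℝ (hU x)).inv (norm_ne_zero_iff.2 (hU x))).smul contDiffAt_id
  have h2 := h1.codRestrict_sphere (n := d) (fun x => by simp [norm_smul, hU x])
  have h3 := hf.comp h2
  intro x hx
  have h4 := h3 ⟨x, hx⟩
  have h5 : (f ∘ Set.codRestrict (fun x : U => ‖(x : EuclideanSpace ℝ (Fin (d + 1)))‖⁻¹ •
      (x : EuclideanSpace ℝ (Fin (d + 1)))) (Metric.sphere 0 1)
      (fun x => by simp [norm_smul, hU x])) =
      fun x : U => (fun x => f (dir x)) (x : EuclideanSpace ℝ (Fin (d + 1))) := by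
    funext x
    simp only [Function.comp_apply]
    congr 1
    apply Subtype.ext
    rw [dir_coe (hU x)]
    rfl
  rw [h5] at h4
  exact ((contMDiffAt_subtype_iff (f := fun x => f (dir x))).1 h4).contDiffAt.contDiffWithinAt

/-- The great circle through `ω` with direction `e`. -/
def greatCircle (ω e : EuclideanSpace ℝ (Fin (d + 1))) (θ : ℝ) : EuclideanSpace ℝ (Fin (d + 1)) :=
  Real.cos θ • ω + Real.sin θ • e

theorem hasDerivAt_greatCircle (ω e : EuclideanSpace ℝ (Fin (d + 1))) :
    HasDerivAt (greatCircle ω e) e 0 := by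
  have h := ((Real.hasDerivAt_cos 0).smul_const ω).add ((Real.hasDerivAt_sin 0).smul_const e)
  exact h.congr_deriv (by simp)

theorem greatCircle_zero (ω e : EuclideanSpace ℝ (Fin (d + 1))) : greatCircle ω e 0 = ω := by
  simp [greatCircle]

theorem greatCircle_mem_sphere {ω e : EuclideanSpace ℝ (Fin (d + 1))} (hω : ‖ω‖ = 1) (he : ‖e‖ = 1)
    (h : ⟪ω, e⟫ = 0) (θ : ℝ) :
    greatCircle ω e θ ∈ Metric.sphere (0 : EuclideanSpace ℝ (Fin (d + 1))) 1 := by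
  rw [mem_sphere_zero_iff_norm, ← sq_eq_sq₀ (norm_nonneg _) zero_le_one, greatCircle,
    norm_add_sq_real, inner_smul_left, inner_smul_right, h, norm_smul, norm_smul, hω, he]
  simp

theorem angle_greatCircle {ω e : EuclideanSpace ℝ (Fin (d + 1))} (hω : ‖ω‖ = 1) (he : ‖e‖ = 1)
    (h : ⟪ω, e⟫ = 0) {θ : ℝ} (hθ : |θ| ≤ Real.pi) :
    InnerProductGeometry.angle (greatCircle ω e θ) ω = |θ| := by
  rw [InnerProductGeometry.angle, mem_sphere_zero_iff_norm.1 (greatCircle_mem_sphere hω he h θ), hω,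
    greatCircle, inner_add_left, inner_smul_left, inner_smul_left, real_inner_comm ω e, h,
    real_inner_self_eq_norm_sq, hω, ← Real.arccos_cos (abs_nonneg θ) hθ, Real.cos_abs]
  simp

/-- Two Taylor vectors at a point agree in tangential directions. -/
theorem IsTaylorVector.inner_eq {ω : Sph (d + 1)} {w w' : EuclideanSpace ℝ (Fin (d + 1))}
    (hw : IsTaylorVector f ω w) (hw' : IsTaylorVector f ω w')
    {e : EuclideanSpace ℝ (Fin (d + 1))} (he : ‖e‖ = 1)
    (h : ⟪(ω : EuclideanSpace ℝ (Fin (d + 1))), e⟫ = 0) : ⟪w, e⟫ = ⟪w', e⟫ := by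
  have hω : ‖(ω : EuclideanSpace ℝ (Fin (d + 1)))‖ = 1 := norm_eq_of_mem_sphere ω
  have h1 : (fun y : Sph (d + 1) => ⟪w - w', (y : EuclideanSpace ℝ (Fin (d + 1))) - ω⟫) =o[𝓝 ω]
      fun y : Sph (d + 1) => (y : EuclideanSpace ℝ (Fin (d + 1))) - ω := by
    refine (hw'.sub hw).congr_left fun y => ?_
    rw [inner_sub_left]; ring
  -- Along the great circle leaving ω in direction e, the pairing with w - w' has derivative 0 by
  -- the two expansions and ⟨w - w', e⟩ by direct computation.
  let c : ℝ → Sph (d + 1) := fun θ => ⟨greatCircle ω e θ, greatCircle_mem_sphere hω he h θ⟩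
  have hd := hasDerivAt_greatCircle (ω : EuclideanSpace ℝ (Fin (d + 1))) e
  have hc : Tendsto c (𝓝 0) (𝓝 ω) := by
    rw [tendsto_subtype_rng]
    have := hd.continuousAt.tendsto
    rwa [greatCircle_zero] at this
  have h2 := h1.comp_tendsto hc
  have h3 : (fun θ => greatCircle (ω : EuclideanSpace ℝ (Fin (d + 1))) e θ - ω) =O[𝓝 0]
      fun θ : ℝ => θ := by
    have := hd.isBigO_sub
    simpa [greatCircle_zero] using this
  have h4 := h2.trans_isBigO h3
  have h5 : HasDerivAt (fun θ => ⟪w - w', greatCircle (ω : EuclideanSpace ℝ (Fin (d + 1))) e θ⟫)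
      0 0 := by
    rw [hasDerivAt_iff_isLittleO]
    refine h4.congr (fun θ => ?_) (fun θ => by simp)
    simp [c, inner_sub_right, greatCircle_zero]
  have h6 : HasDerivAt (fun θ => ⟪w - w', greatCircle (ω : EuclideanSpace ℝ (Fin (d + 1))) e θ⟫)
      ⟪w - w', e⟫ 0 := (innerSL ℝ (w - w')).hasFDerivAt.comp_hasDerivAt (0 : ℝ) hd
  have h7 := h6.unique h5
  rwa [inner_sub_left, sub_eq_zero] at h7

/-- A tangential Taylor vector is the spherical gradient. -/
theorem IsTaylorVector.isSphericalGradient {ω : Sph (d + 1)} {w : EuclideanSpace ℝ (Fin (d + 1))}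
    (hw : IsTaylorVector f ω w) (h : ⟪(ω : EuclideanSpace ℝ (Fin (d + 1))), w⟫ = 0) :
    IsSphericalGradient f ω w := by
  refine ⟨hw, fun w' hw' => ?_⟩
  rcases eq_or_ne w 0 with rfl | h0
  · simp
  have h0' : ‖w‖ ≠ 0 := norm_ne_zero_iff.2 h0
  have he : ‖‖w‖⁻¹ • w‖ = 1 := by simp [norm_smul, h0']
  have h1 := hw.inner_eq hw' he (by rw [inner_smul_right, h, mul_zero])
  calc ‖w‖ = ⟪w, ‖w‖⁻¹ • w⟫ := by
        rw [inner_smul_right, real_inner_self_eq_norm_sq]; field_simp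
    _ = ⟪w', ‖w‖⁻¹ • w⟫ := h1
    _ ≤ ‖w'‖ * ‖‖w‖⁻¹ • w‖ := real_inner_le_norm _ _
    _ = ‖w'‖ := by rw [he, mul_one]

theorem hasGradientAt_comp_dir_gradient (hf : ContMDiff (𝓡 d) 𝓘(ℝ, ℝ) 1 f)
    {x : EuclideanSpace ℝ (Fin (d + 1))} (hx : x ≠ 0) :
    HasGradientAt (fun x => f (dir x)) (gradient (fun x => f (dir x)) x) x :=
  (((contDiffOn_comp_dir hf).contDiffAt (isOpen_compl_singleton.mem_nhds hx)).differentiableAt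
    one_ne_zero).hasGradientAt

/-- The extension is constant along rays, so its radial derivative vanishes. Hence its gradient on
the sphere is tangential, which makes it the shortest Taylor vector. -/
theorem inner_gradient_comp_dir (hf : ContMDiff (𝓡 d) 𝓘(ℝ, ℝ) 1 f)
    {x : EuclideanSpace ℝ (Fin (d + 1))} (hx : x ≠ 0) :
    ⟪x, gradient (fun x => f (dir x)) x⟫ = 0 := by
  have h1 : HasDerivAt (fun r : ℝ => r • x) x 1 := by
    simpa using (hasDerivAt_id (1 : ℝ)).smul_const x
  have h0 : HasFDerivAt (fun x => f (dir x)) (innerSL ℝ (gradient (fun x => f (dir x)) x))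
      ((1 : ℝ) • x) := by
    rw [one_smul]; exact (hasGradientAt_comp_dir_gradient hf hx).hasFDerivAt
  have h2 := h0.comp_hasDerivAt (1 : ℝ) h1
  have h3 : HasDerivAt ((fun x => f (dir x)) ∘ fun r : ℝ => r • x) 0 1 := by
    refine (hasDerivAt_const (1 : ℝ) (f (dir x))).congr_of_eventuallyEq ?_
    filter_upwards [lt_mem_nhds one_pos] with r hr
    simp [dir_smul hr]
  rw [real_inner_comm]
  exact h2.unique h3

theorem gradient_comp_dir_smul (hf : ContMDiff (𝓡 d) 𝓘(ℝ, ℝ) 1 f)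
    {x : EuclideanSpace ℝ (Fin (d + 1))} (hx : x ≠ 0) {r : ℝ} (hr : 0 < r) :
    gradient (fun x => f (dir x)) (r • x) = r⁻¹ • gradient (fun x => f (dir x)) x := by
  have h0 : HasFDerivAt (fun x => f (dir x))
      (innerSL ℝ (gradient (fun x => f (dir x)) (r • x))) (r • x) :=
    (hasGradientAt_comp_dir_gradient hf (smul_ne_zero hr.ne' hx)).hasFDerivAt
  have h1 := h0.comp x ((hasFDerivAt_id x).const_smul r)
  have h2 : ((fun x => f (dir x)) ∘ fun y => r • id y) = fun x => f (dir x) := by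
    funext y; simp [dir_smul hr]
  have h3 : HasGradientAt (fun x => f (dir x)) (r • gradient (fun x => f (dir x)) (r • x)) x := by
    rw [hasGradientAt_iff_hasFDerivAt]
    change HasFDerivAt ((fun x => f (dir x)) ∘ fun y => r • id y) _ x at h1
    rw [h2] at h1
    refine h1.congr_fderiv ?_
    ext y
    simp
  rw [h3.gradient, smul_smul, inv_mul_cancel₀ hr.ne', one_smul]

theorem isSphericalGradient_gradient (hf : ContMDiff (𝓡 d) 𝓘(ℝ, ℝ) 1 f) (ω : Sph (d + 1)) :
    IsSphericalGradient f ω (gradient (fun x => f (dir x)) ω) := by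
  have hω : (ω : EuclideanSpace ℝ (Fin (d + 1))) ≠ 0 := ne_zero_of_mem_unit_sphere ω
  refine IsTaylorVector.isSphericalGradient ?_ (inner_gradient_comp_dir hf hω)
  have h := hasGradientAt_iff_isLittleO.1 (hasGradientAt_comp_dir_gradient hf hω)
  have h2 := h.comp_tendsto (continuous_subtype_val.tendsto ω)
  refine h2.congr_left fun y => ?_
  simp [dir_sphere]

theorem sgrad_eq_gradient (hf : ContMDiff (𝓡 d) 𝓘(ℝ, ℝ) 1 f) (ω : Sph (d + 1)) :
    sgrad f ω = gradient (fun x => f (dir x)) ω :=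
  (isSphericalGradient_gradient hf ω).sgrad_eq

theorem inner_sgrad (hf : ContMDiff (𝓡 d) 𝓘(ℝ, ℝ) 1 f) (ω : Sph (d + 1)) :
    ⟪(ω : EuclideanSpace ℝ (Fin (d + 1))), sgrad f ω⟫ = 0 := by
  rw [sgrad_eq_gradient hf]
  exact inner_gradient_comp_dir hf (ne_zero_of_mem_unit_sphere ω)

/-- The gradient of the homogeneous extension of a `C¹` function on the sphere. -/
theorem hasGradientAt_comp_dir (hf : ContMDiff (𝓡 d) 𝓘(ℝ, ℝ) 1 f)
    {x : EuclideanSpace ℝ (Fin (d + 1))} (hx : x ≠ 0) :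
    HasGradientAt (fun x => f (dir x)) (‖x‖⁻¹ • sgrad f (dir x)) x := by
  have hx' : 0 < ‖x‖ := norm_pos_iff.2 hx
  have h := gradient_comp_dir_smul hf (ne_zero_of_mem_unit_sphere (dir x)) hx'
  have e : ‖x‖ • (dir x : EuclideanSpace ℝ (Fin (d + 1))) = x := by
    rw [dir_coe hx, smul_smul, mul_inv_cancel₀ hx'.ne', one_smul]
  rw [e, ← sgrad_eq_gradient hf] at h
  rw [← h]
  exact hasGradientAt_comp_dir_gradient hf hx

theorem continuous_sgrad (hf : ContMDiff (𝓡 d) 𝓘(ℝ, ℝ) 1 f) : Continuous (sgrad f) := by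
  rw [funext (sgrad_eq_gradient hf)]
  have h := (contDiffOn_comp_dir hf).continuousOn_fderiv_of_isOpen isOpen_compl_singleton le_rfl
  have h2 : Continuous fun ω : Sph (d + 1) => fderiv ℝ (fun x => f (dir x))
      (ω : EuclideanSpace ℝ (Fin (d + 1))) :=
    h.comp_continuous continuous_subtype_val fun ω => ne_zero_of_mem_unit_sphere ω
  exact (InnerProductSpace.toDual ℝ _).symm.continuous.comp h2

/-- A function that is `1`-Lipschitz for the geodesic distance has spherical gradient of norm at
most `1`. -/
theorem norm_sgrad_le_one (hf : ContMDiff (𝓡 d) 𝓘(ℝ, ℝ) 1 f)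
    (hlip : ∀ x y : Sph (d + 1), |f x - f y| ≤
      InnerProductGeometry.angle (x : EuclideanSpace ℝ (Fin (d + 1))) y) (ω : Sph (d + 1)) :
    ‖sgrad f ω‖ ≤ 1 := by
  have hω : ‖(ω : EuclideanSpace ℝ (Fin (d + 1)))‖ = 1 := norm_eq_of_mem_sphere ω
  have hω0 : (ω : EuclideanSpace ℝ (Fin (d + 1))) ≠ 0 := ne_zero_of_mem_unit_sphere ω
  rcases eq_or_ne (sgrad f ω) 0 with h0 | h0
  · simp [h0]
  have h0' : ‖sgrad f ω‖ ≠ 0 := norm_ne_zero_iff.2 h0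
  set e := ‖sgrad f ω‖⁻¹ • sgrad f ω with he_def
  have he : ‖e‖ = 1 := by simp [e, norm_smul, h0']
  have h : ⟪(ω : EuclideanSpace ℝ (Fin (d + 1))), e⟫ = 0 := by
    rw [he_def, inner_smul_right, inner_sgrad hf, mul_zero]
  have h1 : HasFDerivAt (fun x => f (dir x)) (innerSL ℝ (sgrad f ω))
      (greatCircle (ω : EuclideanSpace ℝ (Fin (d + 1))) e 0) := by
    rw [greatCircle_zero, sgrad_eq_gradient hf]
    exact (hasGradientAt_comp_dir_gradient hf hω0).hasFDerivAt
  have h2 := h1.comp_hasDerivAt (0 : ℝ) (hasDerivAt_greatCircle _ e)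
  -- For small θ the geodesic distance travelled along the great circle is |θ|, so the derivative at
  -- 0 in the direction of the gradient is at most 1; that derivative is the norm of the gradient.
  have h3 := h2.le_of_lip' zero_le_one (by
    filter_upwards [Metric.ball_mem_nhds (0 : ℝ) Real.pi_pos] with θ hθ
    have hθ' : |θ| ≤ Real.pi := by simpa using (Metric.mem_ball.1 hθ).le
    have h4 := hlip ⟨_, greatCircle_mem_sphere hω he h θ⟩ ω
    rw [angle_greatCircle hω he h hθ'] at h4
    simp only [Function.comp_apply, greatCircle_zero, dir_sphere, one_mul, sub_zero,
      Real.norm_eq_abs]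
    rwa [← dir_sphere ⟨_, greatCircle_mem_sphere hω he h θ⟩] at h4)
  have h5 : ⟪sgrad f ω, e⟫ = ‖sgrad f ω‖ := by
    rw [he_def, inner_smul_right, real_inner_self_eq_norm_sq]; field_simp
  simpa [h5] using h3

end gradient

/-! ### Regularization at the origin and transfer to the sphere -/

section regularization

variable {d : ℕ} {f g : Sph (d + 1) → ℝ}

/-- A regularization at the origin of the homogeneous extension of `f`. -/
def regularize (f : Sph (d + 1) → ℝ) (ε : ℝ) (x : EuclideanSpace ℝ (Fin (d + 1))) : ℝ :=
  ‖x‖ ^ 2 / (‖x‖ ^ 2 + ε) * f (dir x)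

/-- The gradient of `regularize f ε`. -/
def regularizeGrad (f : Sph (d + 1) → ℝ) (ε : ℝ) (x : EuclideanSpace ℝ (Fin (d + 1))) :
    EuclideanSpace ℝ (Fin (d + 1)) :=
  (‖x‖ ^ 2 / (‖x‖ ^ 2 + ε)) • ‖x‖⁻¹ • sgrad f (dir x) +
    (f (dir x) * (2 * ε / (‖x‖ ^ 2 + ε) ^ 2)) • x

theorem abs_regularize_le {M ε : ℝ} (hε : 0 < ε) (hM : ∀ ω, |f ω| ≤ M)
    (x : EuclideanSpace ℝ (Fin (d + 1))) : |regularize f ε x| ≤ M := by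
  have h1 : ‖x‖ ^ 2 / (‖x‖ ^ 2 + ε) ≤ 1 := by
    rw [div_le_one (by positivity)]; linarith
  have h0 : 0 ≤ ‖x‖ ^ 2 / (‖x‖ ^ 2 + ε) := by positivity
  rw [regularize, abs_mul, abs_of_nonneg h0]
  calc _ ≤ 1 * M := mul_le_mul h1 (hM _) (abs_nonneg _) zero_le_one
    _ = M := one_mul M

theorem hasGradientAt_regularize (hf : ContMDiff (𝓡 d) 𝓘(ℝ, ℝ) 1 f) {ε : ℝ} (hε : 0 < ε)
    {M : ℝ} (hM : ∀ ω, |f ω| ≤ M) (x : EuclideanSpace ℝ (Fin (d + 1))) :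
    HasGradientAt (regularize f ε) (regularizeGrad f ε x) x := by
  rcases eq_or_ne x 0 with rfl | hx
  · rw [hasGradientAt_iff_isLittleO]
    -- The factor makes the function quadratically small at the origin, so its gradient there is 0
    -- although f(y/|y|) need not have a limit.
    have h1 : (fun y : EuclideanSpace ℝ (Fin (d + 1)) => regularize f ε y) =O[𝓝 0]
        fun y => ‖y‖ ^ 2 := by
      refine Asymptotics.IsBigO.of_bound (M / ε) (Eventually.of_forall fun y => ?_)
      have h2 : ‖y‖ ^ 2 / (‖y‖ ^ 2 + ε) ≤ ‖y‖ ^ 2 / ε :=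
        div_le_div_of_nonneg_left (by positivity) hε (by nlinarith [sq_nonneg ‖y‖])
      rw [regularize, norm_mul, Real.norm_of_nonneg (by positivity), Real.norm_eq_abs,
        Real.norm_of_nonneg (by positivity)]
      calc _ ≤ ‖y‖ ^ 2 / ε * M := mul_le_mul h2 (hM _) (abs_nonneg _) (by positivity)
        _ = _ := by ring
    have h3 : (fun y : EuclideanSpace ℝ (Fin (d + 1)) => ‖y‖ ^ 2) =o[𝓝 0] fun y => y := by
      have := Asymptotics.isLittleO_norm_pow_id (E' := EuclideanSpace ℝ (Fin (d + 1))) one_lt_two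
      exact this
    refine (h1.trans_isLittleO h3).congr (fun y => ?_) (fun y => by simp)
    simp [regularize, regularizeGrad]
  · have h1 : HasFDerivAt (fun x : EuclideanSpace ℝ (Fin (d + 1)) => ‖x‖ ^ 2)
        (2 • innerSL ℝ x) x := (hasStrictFDerivAt_norm_sq x).hasFDerivAt
    have hpos : ‖x‖ ^ 2 + ε ≠ 0 := by positivity
    have h3 : HasFDerivAt (fun x => f (dir x)) (innerSL ℝ (‖x‖⁻¹ • sgrad f (dir x))) x :=
      (hasGradientAt_comp_dir hf hx).hasFDerivAt
    have h2 : HasDerivAt (fun a : ℝ => a / (a + ε)) (ε / (‖x‖ ^ 2 + ε) ^ 2) (‖x‖ ^ 2) := by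
      refine ((hasDerivAt_id _).fun_div ((hasDerivAt_id _).add_const ε) hpos).congr_deriv ?_
      simp
    have h4 := (h2.comp_hasFDerivAt x h1).mul h3
    rw [hasGradientAt_iff_hasFDerivAt]
    refine h4.congr_fderiv ?_
    ext y
    simp [regularizeGrad]
    ring

/-- One profile serves two purposes. For fixed 0 < ε ≤ 1 it is bounded, as the Gaussian inequality
requires; uniformly in ε > 0 it is at most |x|⁻¹, as dominated convergence requires. -/
theorem norm_regularizeGrad_le {ε K M : ℝ} (hε : 0 < ε) (hM : ∀ ω, |f ω| ≤ M)
    (hK : ∀ ω, ‖sgrad f ω‖ ≤ K) (x : EuclideanSpace ℝ (Fin (d + 1))) :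
    ‖regularizeGrad f ε x‖ ≤ (K + 2 * M) * (‖x‖ / (‖x‖ ^ 2 + ε)) := by
  have hM0 : 0 ≤ M := (abs_nonneg _).trans (hM (dir 0))
  rcases eq_or_ne x 0 with rfl | hx
  · simp [regularizeGrad]
  have hx' : 0 < ‖x‖ := norm_pos_iff.2 hx
  refine (norm_add_le _ _).trans ?_
  have a1 : 0 ≤ ‖x‖ ^ 2 / (‖x‖ ^ 2 + ε) := by positivity
  have a2 : 0 ≤ 2 * ε / (‖x‖ ^ 2 + ε) ^ 2 := by positivity
  rw [norm_smul, norm_smul, norm_smul, norm_mul, norm_inv, norm_norm, Real.norm_of_nonneg a1,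
    Real.norm_of_nonneg a2, Real.norm_eq_abs, add_mul]
  refine add_le_add ?_ ?_
  · have e : ‖x‖ ^ 2 / (‖x‖ ^ 2 + ε) * (‖x‖⁻¹ * ‖sgrad f (dir x)‖) =
        ‖sgrad f (dir x)‖ * (‖x‖ / (‖x‖ ^ 2 + ε)) := by field_simp
    rw [e]
    exact mul_le_mul_of_nonneg_right (hK _) (by positivity)
  · have e : |f (dir x)| * (2 * ε / (‖x‖ ^ 2 + ε) ^ 2) * ‖x‖ =
        2 * (|f (dir x)| * (ε / (‖x‖ ^ 2 + ε))) * (‖x‖ / (‖x‖ ^ 2 + ε)) := by field_simp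
    have h1 : ε / (‖x‖ ^ 2 + ε) ≤ 1 := by
      rw [div_le_one (by positivity)]; nlinarith [sq_nonneg ‖x‖]
    rw [e]
    refine mul_le_mul_of_nonneg_right (mul_le_mul_of_nonneg_left ?_ zero_le_two) (by positivity)
    calc _ ≤ M * 1 := mul_le_mul (hM _) h1 (by positivity) hM0
      _ = M := mul_one M

theorem norm_div_sq_add_le_inv {ε : ℝ} (hε : 0 < ε) (x : EuclideanSpace ℝ (Fin (d + 1))) :
    ‖x‖ / (‖x‖ ^ 2 + ε) ≤ ‖x‖⁻¹ := by
  rcases eq_or_ne x 0 with rfl | hx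
  · simp
  have hx' : 0 < ‖x‖ := norm_pos_iff.2 hx
  rw [div_le_iff₀ (by positivity)]
  field_simp
  linarith

theorem norm_div_sq_add_le {ε : ℝ} (hε : 0 < ε) (hε1 : ε ≤ 1)
    (x : EuclideanSpace ℝ (Fin (d + 1))) : ‖x‖ / (‖x‖ ^ 2 + ε) ≤ ε⁻¹ := by
  rw [div_le_iff₀ (by positivity), inv_mul_eq_div, le_div_iff₀ hε]
  nlinarith [sq_nonneg (‖x‖ - ε), norm_nonneg x]

theorem measurable_regularizeGrad (hf : ContMDiff (𝓡 d) 𝓘(ℝ, ℝ) 1 f) (ε : ℝ) :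
    Measurable (regularizeGrad f ε) := by
  have h1 : Measurable (sgrad f) := (continuous_sgrad hf).measurable
  have h2 : Measurable f := hf.continuous.measurable
  unfold regularizeGrad
  fun_prop

theorem tendsto_sq_div_sq_add {x : EuclideanSpace ℝ (Fin (d + 1))} (hx : x ≠ 0) {ε : ℕ → ℝ}
    (hε : Tendsto ε atTop (𝓝 0)) :
    Tendsto (fun k => ‖x‖ ^ 2 / (‖x‖ ^ 2 + ε k)) atTop (𝓝 1) := by
  have hx' : ‖x‖ ^ 2 ≠ 0 := pow_ne_zero _ (norm_ne_zero_iff.2 hx)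
  have h := (tendsto_const_nhds (x := ‖x‖ ^ 2)).div (hε.const_add (‖x‖ ^ 2)) (by simpa using hx')
  simpa [div_self hx', Pi.div_def] using h

theorem tendsto_regularizeGrad (f : Sph (d + 1) → ℝ) (x : EuclideanSpace ℝ (Fin (d + 1)))
    {ε : ℕ → ℝ} (hε : Tendsto ε atTop (𝓝 0)) :
    Tendsto (fun k => regularizeGrad f (ε k) x) atTop (𝓝 (‖x‖⁻¹ • sgrad f (dir x))) := by
  rcases eq_or_ne x 0 with rfl | hx
  -- At the origin both sides vanish by the convention 0⁻¹ = 0, so the convergence holds everywhere.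
  · simp [regularizeGrad]
  have hx' : ‖x‖ ^ 2 ≠ 0 := pow_ne_zero _ (norm_ne_zero_iff.2 hx)
  have h2 : Tendsto (fun k => 2 * ε k / (‖x‖ ^ 2 + ε k) ^ 2) atTop (𝓝 0) := by
    have h := (hε.const_mul 2).div ((hε.const_add (‖x‖ ^ 2)).pow 2) (by simpa using hx')
    simpa [Pi.div_def] using h
  have h3 := ((tendsto_sq_div_sq_add hx hε).smul_const (‖x‖⁻¹ • sgrad f (dir x))).add
    ((h2.const_mul (f (dir x))).smul_const x)
  simpa [regularizeGrad] using h3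

theorem tendsto_integral_gauss_regularize {u : ℕ → EuclideanSpace ℝ (Fin (d + 1)) → ℝ}
    {h : Sph (d + 1) → ℝ} (hh : Measurable h) {M : ℝ} (hu : ∀ k, Measurable (u k))
    (huM : ∀ k x, |u k x| ≤ M)
    (hlim : ∀ x, x ≠ 0 → Tendsto (fun k => u k x) atTop (𝓝 (h (dir x)))) :
    Tendsto (fun k => ∫ x, u k x ∂gauss (EuclideanSpace ℝ (Fin (d + 1)))) atTop
      (𝓝 (∫ ω, h ω ∂unif (d + 1))) := by
  have e : ∫ ω, h ω ∂unif (d + 1) =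
      ∫ x, h (dir x) ∂gauss (EuclideanSpace ℝ (Fin (d + 1))) := by
    rw [← gauss_map_dir, integral_map measurable_dir.aemeasurable hh.aestronglyMeasurable]
  rw [e]
  refine tendsto_integral_of_dominated_convergence (fun _ => M)
    (fun k => (hu k).aestronglyMeasurable) (integrable_const M)
    (fun k => Eventually.of_forall fun x => huM k x) ?_
  have h0 : ∀ᵐ x ∂(gauss (EuclideanSpace ℝ (Fin (d + 1)))), x ≠ 0 :=
    (withDensity_absolutelyContinuous _ _).ae_le (Measure.ae_ne volume 0)
  filter_upwards [h0] with x hx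
  exact hlim x hx

theorem exists_bound_of_continuous {F : Type*} [SeminormedAddCommGroup F] {h : Sph (d + 1) → F}
    (hh : Continuous h) : ∃ M, ∀ ω, ‖h ω‖ ≤ M := by
  obtain ⟨M, hM⟩ := isCompact_univ.exists_bound_of_continuousOn hh.continuousOn
  exact ⟨M, fun ω => hM ω (mem_univ ω)⟩

/-- The covariance of two `C¹` functions on the sphere is bounded through their spherical gradients
and the mixing measure. -/
theorem enorm_covariance_le (hd : 1 ≤ d) (hf : ContMDiff (𝓡 d) 𝓘(ℝ, ℝ) 1 f)
    (hg : ContMDiff (𝓡 d) 𝓘(ℝ, ℝ) 1 g) :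
    ‖cov[f, g; unif (d + 1)]‖ₑ ≤
      ∫⁻ p, ‖sgrad f p.1‖ₑ * ‖sgrad g p.2‖ₑ ∂mixingMeasure (d + 1) := by
  have := isProbabilityMeasure_unif (d + 1) (by omega)
  have := isFiniteMeasure_mixingMeasure (n := d + 1) (by omega)
  have hfm : Measurable f := hf.continuous.measurable
  have hgm : Measurable g := hg.continuous.measurable
  have hsf : Measurable (sgrad f) := (continuous_sgrad hf).measurable
  have hsg : Measurable (sgrad g) := (continuous_sgrad hg).measurable
  obtain ⟨M₁, hM₁⟩ := exists_bound_of_continuous hf.continuous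
  obtain ⟨M₂, hM₂⟩ := exists_bound_of_continuous hg.continuous
  obtain ⟨K₁, hK₁⟩ := exists_bound_of_continuous (continuous_sgrad hf)
  obtain ⟨K₂, hK₂⟩ := exists_bound_of_continuous (continuous_sgrad hg)
  set M := max M₁ M₂
  set K := max K₁ K₂
  have hMf : ∀ ω, |f ω| ≤ M := fun ω => (hM₁ ω).trans (le_max_left _ _)
  have hMg : ∀ ω, |g ω| ≤ M := fun ω => (hM₂ ω).trans (le_max_right _ _)
  have hKf : ∀ ω, ‖sgrad f ω‖ ≤ K := fun ω => (hK₁ ω).trans (le_max_left _ _)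
  have hKg : ∀ ω, ‖sgrad g ω‖ ≤ K := fun ω => (hK₂ ω).trans (le_max_right _ _)
  have hM0 : 0 ≤ M := (abs_nonneg _).trans (hMf (dir 0))
  have hK0 : 0 ≤ K := (norm_nonneg _).trans (hKf (dir 0))
  set ε : ℕ → ℝ := fun k => 1 / ((k : ℝ) + 1)
  have hε0 : ∀ k, 0 < ε k := fun k => by positivity
  have hε1 : ∀ k, ε k ≤ 1 := fun k => by
    rw [div_le_one (by positivity)]; linarith [Nat.cast_nonneg (α := ℝ) k]
  have hεt : Tendsto ε atTop (𝓝 0) := tendsto_one_div_add_atTop_nhds_zero_nat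
  set L := K + 2 * M
  have hL0 : 0 ≤ L := by positivity
  have key : ∀ k, ‖∫ x, regularize f (ε k) x * regularize g (ε k) x
        ∂gauss (EuclideanSpace ℝ (Fin (d + 1))) -
      (∫ x, regularize f (ε k) x ∂gauss (EuclideanSpace ℝ (Fin (d + 1)))) *
        ∫ x, regularize g (ε k) x ∂gauss (EuclideanSpace ℝ (Fin (d + 1)))‖ₑ ≤
      ∫⁻ p, ‖regularizeGrad f (ε k) p.1‖ₑ * ‖regularizeGrad g (ε k) p.2‖ₑ
        ∂gaussMix (EuclideanSpace ℝ (Fin (d + 1))) := fun k =>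
    covariance_gauss_le (hasGradientAt_regularize hf (hε0 k) hMf)
      (measurable_regularizeGrad hf _) (abs_regularize_le (hε0 k) hMf)
      (fun x => (norm_regularizeGrad_le (hε0 k) hMf hKf x).trans
        (mul_le_mul_of_nonneg_left (norm_div_sq_add_le (hε0 k) (hε1 k) x) hL0))
      (hasGradientAt_regularize hg (hε0 k) hMg) (abs_regularize_le (hε0 k) hMg)
      (measurable_regularizeGrad hg _)
      (fun x => (norm_regularizeGrad_le (hε0 k) hMg hKg x).trans
        (mul_le_mul_of_nonneg_left (norm_div_sq_add_le (hε0 k) (hε1 k) x) hL0))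
  have hrm : ∀ {h : Sph (d + 1) → ℝ} (k : ℕ), Measurable h → Measurable (regularize h (ε k)) :=
    fun k hh => by unfold regularize; fun_prop
  have hrlim : ∀ (h : Sph (d + 1) → ℝ) (x : EuclideanSpace ℝ (Fin (d + 1))), x ≠ 0 →
      Tendsto (fun k => regularize h (ε k) x) atTop (𝓝 (h (dir x))) := fun h x hx => by
    simpa [regularize] using (tendsto_sq_div_sq_add hx hεt).mul_const (h (dir x))
  have lim1 := tendsto_integral_gauss_regularize (h := fun ω => f ω * g ω) (M := M * M)
    (u := fun k x => regularize f (ε k) x * regularize g (ε k) x) (by fun_prop)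
    (fun k => (hrm k hfm).mul (hrm k hgm))
    (fun k x => by
      rw [abs_mul]
      exact mul_le_mul (abs_regularize_le (hε0 k) hMf x) (abs_regularize_le (hε0 k) hMg x)
        (abs_nonneg _) hM0)
    (fun x hx => (hrlim f x hx).mul (hrlim g x hx))
  have lim2 := tendsto_integral_gauss_regularize (h := f) (u := fun k => regularize f (ε k)) hfm
    (fun k => hrm k hfm) (fun k x => abs_regularize_le (hε0 k) hMf x) (hrlim f)
  have lim3 := tendsto_integral_gauss_regularize (h := g) (u := fun k => regularize g (ε k)) hgm
    (fun k => hrm k hgm) (fun k x => abs_regularize_le (hε0 k) hMg x) (hrlim g)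
  have lim4 := (continuous_enorm.tendsto _).comp (lim1.sub (lim2.mul lim3))
  have hbound : ∀ k (x : EuclideanSpace ℝ (Fin (d + 1))),
      ‖regularizeGrad f (ε k) x‖ ≤ L * ‖x‖⁻¹ ∧ ‖regularizeGrad g (ε k) x‖ ≤ L * ‖x‖⁻¹ :=
    fun k x => ⟨(norm_regularizeGrad_le (hε0 k) hMf hKf x).trans
      (mul_le_mul_of_nonneg_left (norm_div_sq_add_le_inv (hε0 k) x) hL0),
      (norm_regularizeGrad_le (hε0 k) hMg hKg x).trans
      (mul_le_mul_of_nonneg_left (norm_div_sq_add_le_inv (hε0 k) x) hL0)⟩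
  have lim5 : Tendsto (fun k => ∫⁻ p, ‖regularizeGrad f (ε k) p.1‖ₑ *
      ‖regularizeGrad g (ε k) p.2‖ₑ ∂gaussMix (EuclideanSpace ℝ (Fin (d + 1)))) atTop
      (𝓝 (∫⁻ p, ‖‖p.1‖⁻¹ • sgrad f (dir p.1)‖ₑ * ‖‖p.2‖⁻¹ • sgrad g (dir p.2)‖ₑ
        ∂gaussMix (EuclideanSpace ℝ (Fin (d + 1))))) := by
    refine tendsto_lintegral_of_dominated_convergence
      (fun p => ENNReal.ofReal (L * L) * ENNReal.ofReal (‖p.1‖⁻¹ * ‖p.2‖⁻¹)) (fun k => ?_)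
      (fun k => Eventually.of_forall fun p => ?_) ?_ (Eventually.of_forall fun p => ?_)
    · have h1 := measurable_regularizeGrad hf (ε k)
      have h2 := measurable_regularizeGrad hg (ε k)
      fun_prop
    · dsimp only
      rw [← ofReal_norm, ← ofReal_norm, ← ENNReal.ofReal_mul (norm_nonneg _),
        ← ENNReal.ofReal_mul (by positivity)]
      refine ENNReal.ofReal_le_ofReal ?_
      calc _ ≤ (L * ‖p.1‖⁻¹) * (L * ‖p.2‖⁻¹) :=
            mul_le_mul (hbound k _).1 (hbound k _).2 (norm_nonneg _) (by positivity)
        _ = _ := by ring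
    -- The majorant integrates to a multiple of the mass of the mixing measure, which is finite for
    -- n = 2 as well.
    · rw [lintegral_const_mul _ (by fun_prop), ← mixingMeasure_univ (by omega)]
      exact ENNReal.mul_ne_top ENNReal.ofReal_ne_top (measure_ne_top _ _)
    · refine ENNReal.Tendsto.mul ((continuous_enorm.tendsto _).comp
        (tendsto_regularizeGrad f p.1 hεt)) (Or.inr enorm_ne_top)
        ((continuous_enorm.tendsto _).comp (tendsto_regularizeGrad g p.2 hεt))
        (Or.inr enorm_ne_top)
  have hle := le_of_tendsto_of_tendsto' lim4 lim5 key
  have hhom : ∀ (h : Sph (d + 1) → ℝ) (r : ℝ), 0 < r → ∀ x : EuclideanSpace ℝ (Fin (d + 1)),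
      ‖‖r • x‖⁻¹ • sgrad h (dir (r • x))‖ₑ = ENNReal.ofReal r⁻¹ * ‖‖x‖⁻¹ • sgrad h (dir x)‖ₑ := by
    intro h r hr x
    rw [dir_smul hr, norm_smul, Real.norm_of_nonneg hr.le, mul_inv, mul_smul, enorm_smul,
      Real.enorm_of_nonneg (by positivity)]
  rw [lintegral_gaussMix_of_homogeneous (F := fun x => ‖‖x‖⁻¹ • sgrad f (dir x)‖ₑ)
    (G := fun x => ‖‖x‖⁻¹ • sgrad g (dir x)‖ₑ) (by omega) (by fun_prop) (by fun_prop)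
    (hhom f) (hhom g)] at hle
  simp only [norm_eq_of_mem_sphere, inv_one, one_smul, dir_sphere] at hle
  have hLpf : MemLp f 2 (unif (d + 1)) :=
    MemLp.of_bound hfm.aestronglyMeasurable M (Eventually.of_forall hMf)
  have hLpg : MemLp g 2 (unif (d + 1)) :=
    MemLp.of_bound hgm.aestronglyMeasurable M (Eventually.of_forall hMg)
  rw [covariance_eq_sub hLpf hLpg]
  exact hle

end regularization

/-! ### Hölder's inequality for the mixing measure -/

section holder

variable {n : ℕ} [NeZero n] {F : Type*} [NormedAddCommGroup F]

theorem eLpNorm_mixingMeasure_fst {h : Sph n → F} (hh : AEStronglyMeasurable h (unif n))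
    (h0 : mixingMeasure n univ ≠ 0) (p : ℝ≥0∞) :
    eLpNorm (fun z => h z.1) p (mixingMeasure n) =
      mixingMeasure n univ ^ (1 / p).toReal * eLpNorm h p (unif n) := by
  rw [← smul_eq_mul, ← eLpNorm_smul_measure_of_ne_zero h0, ← mixingMeasure_map_fst,
    eLpNorm_map_measure _ measurable_fst.aemeasurable]
  · rfl
  · rw [mixingMeasure_map_fst]
    exact hh.smul_measure _

theorem eLpNorm_mixingMeasure_snd {h : Sph n → F} (hh : AEStronglyMeasurable h (unif n))
    (h0 : mixingMeasure n univ ≠ 0) (p : ℝ≥0∞) :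
    eLpNorm (fun z => h z.2) p (mixingMeasure n) =
      mixingMeasure n univ ^ (1 / p).toReal * eLpNorm h p (unif n) := by
  rw [← smul_eq_mul, ← eLpNorm_smul_measure_of_ne_zero h0, ← mixingMeasure_map_snd,
    eLpNorm_map_measure _ measurable_snd.aemeasurable]
  · rfl
  · rw [mixingMeasure_map_snd]
    exact hh.smul_measure _

/-- Hölder's inequality for the mixing measure. -/
theorem lintegral_mixingMeasure_le [IsFiniteMeasure (mixingMeasure n)] {h k : Sph n → F}
    (hh : AEStronglyMeasurable h (unif n)) (hk : AEStronglyMeasurable k (unif n)) {p q : ℝ≥0∞}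
    (hpq : 1 / p + 1 / q = 1) :
    ∫⁻ z, ‖h z.1‖ₑ * ‖k z.2‖ₑ ∂mixingMeasure n ≤
      mixingMeasure n univ * eLpNorm h p (unif n) * eLpNorm k q (unif n) := by
  -- Zero mass is set apart because at exponent ∞ the scaling factor would be 0⁰ = 1.
  rcases eq_or_ne (mixingMeasure n univ) 0 with h0 | h0
  · rw [Measure.measure_univ_eq_zero.1 h0]
    simp
  have hp : 1 / p ≠ ∞ := fun h => by simp [h] at hpq
  have hq : 1 / q ≠ ∞ := fun h => by simp [h] at hpq
  have : ENNReal.HolderTriple p q 1 := ⟨by simpa using hpq⟩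
  have m1 : AEStronglyMeasurable (fun z : Sph n × Sph n => ‖h z.1‖) (mixingMeasure n) := by
    refine AEStronglyMeasurable.norm (AEStronglyMeasurable.comp_measurable ?_ measurable_fst)
    rw [mixingMeasure_map_fst]
    exact hh.smul_measure _
  have m2 : AEStronglyMeasurable (fun z : Sph n × Sph n => ‖k z.2‖) (mixingMeasure n) := by
    refine AEStronglyMeasurable.norm (AEStronglyMeasurable.comp_measurable ?_ measurable_snd)
    rw [mixingMeasure_map_snd]
    exact hk.smul_measure _
  have key := eLpNorm_smul_le_mul_eLpNorm (p := p) (q := q) (r := 1) m2 m1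
  rw [eLpNorm_one_eq_lintegral_enorm] at key
  -- The two marginals contribute the mass to the powers 1/p and 1/q, so the constant does not
  -- depend on the exponents.
  have e : (mixingMeasure n univ) ^ (1 / p).toReal * (mixingMeasure n univ) ^ (1 / q).toReal =
      mixingMeasure n univ := by
    rw [← ENNReal.rpow_add _ _ h0 (measure_ne_top _ _), ← ENNReal.toReal_add hp hq, hpq]
    simp
  rw [eLpNorm_norm (fun z : Sph n × Sph n => h z.1), eLpNorm_norm (fun z : Sph n × Sph n => k z.2),
    eLpNorm_mixingMeasure_fst hh h0, eLpNorm_mixingMeasure_snd hk h0, mul_mul_mul_comm, e,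
    ← mul_assoc] at key
  simpa [enorm_mul] using key

end holder

/-! ### Coordinate functions and the lower bound for the constant -/

section coordinate

variable {d : ℕ}

theorem contMDiff_coordinate (d : ℕ) : ContMDiff (𝓡 d) 𝓘(ℝ, ℝ) 1
    fun ω : Sph (d + 1) => (ω : EuclideanSpace ℝ (Fin (d + 1))) 0 := by
  have : Fact (Module.finrank ℝ (EuclideanSpace ℝ (Fin (d + 1))) = d + 1) :=
    ⟨finrank_euclideanSpace_fin⟩
  have h1 : ContMDiff (𝓡 d) 𝓘(ℝ, EuclideanSpace ℝ (Fin (d + 1))) 1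
      ((↑) : Sph (d + 1) → EuclideanSpace ℝ (Fin (d + 1))) := contMDiff_coe_sphere
  have h2 : ContDiff ℝ 1 fun x : EuclideanSpace ℝ (Fin (d + 1)) => x 0 := by fun_prop
  exact h2.contMDiff.comp h1

/-- The gradient is the tangential projection e₀ - ω₀ω of the basis vector: the Taylor remainder is
exactly -(ω₀/2)|y - ω|². -/
theorem norm_sgrad_coordinate (ω : Sph (d + 1)) :
    ‖sgrad (fun ω : Sph (d + 1) => (ω : EuclideanSpace ℝ (Fin (d + 1))) 0) ω‖ =
      √(1 - (ω : EuclideanSpace ℝ (Fin (d + 1))) 0 ^ 2) := by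
  have hω : ‖(ω : EuclideanSpace ℝ (Fin (d + 1)))‖ = 1 := norm_eq_of_mem_sphere ω
  set a := (ω : EuclideanSpace ℝ (Fin (d + 1))) 0 with ha
  set w : EuclideanSpace ℝ (Fin (d + 1)) :=
    EuclideanSpace.single 0 1 - a • (ω : EuclideanSpace ℝ (Fin (d + 1))) with hw
  have hin : ∀ x : EuclideanSpace ℝ (Fin (d + 1)), ⟪EuclideanSpace.single 0 (1 : ℝ), x⟫ = x 0 := by
    intro x; simp [EuclideanSpace.inner_single_left]
  have hsg : IsSphericalGradient
      (fun ω : Sph (d + 1) => (ω : EuclideanSpace ℝ (Fin (d + 1))) 0) ω w := by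
    refine IsTaylorVector.isSphericalGradient ?_ ?_
    · have h1 : (fun y : Sph (d + 1) => (y : EuclideanSpace ℝ (Fin (d + 1))) 0 - a -
          ⟪w, (y : EuclideanSpace ℝ (Fin (d + 1))) - ω⟫) = fun y : Sph (d + 1) =>
          -(a / 2) * ‖(y : EuclideanSpace ℝ (Fin (d + 1))) - ω‖ ^ 2 := by
        funext y
        have hy : ‖(y : EuclideanSpace ℝ (Fin (d + 1)))‖ = 1 := norm_eq_of_mem_sphere y
        rw [norm_sub_sq_real, hy, hω, hw, inner_sub_left, inner_sub_right, inner_sub_right,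
          inner_smul_left, inner_smul_left, real_inner_self_eq_norm_sq, hω, hin, hin, ← ha,
          real_inner_comm]
        simp
        ring
      unfold IsTaylorVector
      rw [h1]
      refine Asymptotics.IsLittleO.const_mul_left ?_ _
      have h2 : Tendsto (fun y : Sph (d + 1) => (y : EuclideanSpace ℝ (Fin (d + 1))) - ω)
          (𝓝 ω) (𝓝 0) := by
        have := (continuous_subtype_val (p := fun x => x ∈ Metric.sphere
          (0 : EuclideanSpace ℝ (Fin (d + 1))) 1)).tendsto ω
        simpa using this.sub_const (ω : EuclideanSpace ℝ (Fin (d + 1)))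
      exact (Asymptotics.isLittleO_norm_pow_id (E' := EuclideanSpace ℝ (Fin (d + 1)))
        one_lt_two).comp_tendsto h2
    · rw [hw, inner_sub_right, inner_smul_right, real_inner_self_eq_norm_sq, hω, real_inner_comm,
        hin, ← ha]
      ring
  rw [hsg.sgrad_eq, ← Real.sqrt_sq (norm_nonneg w), hw, norm_sub_sq_real, inner_smul_right, hin,
    norm_smul, hω, ← ha, mul_pow, Real.norm_eq_abs, sq_abs]
  simp
  ring_nf

/-- By rotation invariance all coordinates have the same second moment, and their squares sum to 1.
-/
theorem lintegral_coordinate_sq (d : ℕ) :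
    ∫⁻ ω : Sph (d + 1), ENNReal.ofReal ((ω : EuclideanSpace ℝ (Fin (d + 1))) 0 ^ 2) ∂unif (d + 1) =
      ENNReal.ofReal (1 / ((d : ℝ) + 1)) := by
  have := isProbabilityMeasure_unif (d + 1) (by omega)
  have h1 : ∀ i : Fin (d + 1), ∫⁻ ω : Sph (d + 1),
      ENNReal.ofReal ((ω : EuclideanSpace ℝ (Fin (d + 1))) i ^ 2) ∂unif (d + 1) =
      ∫⁻ ω : Sph (d + 1), ENNReal.ofReal ((ω : EuclideanSpace ℝ (Fin (d + 1))) 0 ^ 2)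
        ∂unif (d + 1) := by
    intro i
    have h := lintegral_unif_inner (n := d + 1) (φ := fun a => ENNReal.ofReal (a ^ 2))
      (by fun_prop) ⟨EuclideanSpace.single i 1, by simp⟩ ⟨EuclideanSpace.single 0 1, by simp⟩
    simpa [EuclideanSpace.inner_single_left] using h
  have h2 : ∑ i : Fin (d + 1), ∫⁻ ω : Sph (d + 1),
      ENNReal.ofReal ((ω : EuclideanSpace ℝ (Fin (d + 1))) i ^ 2) ∂unif (d + 1) = 1 := by
    rw [← lintegral_finsetSum _ (fun i _ => by fun_prop)]
    have e : ∀ ω : Sph (d + 1), ∑ i : Fin (d + 1),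
        ENNReal.ofReal ((ω : EuclideanSpace ℝ (Fin (d + 1))) i ^ 2) = 1 := by
      intro ω
      rw [← ENNReal.ofReal_sum_of_nonneg (fun i _ => sq_nonneg _), ← EuclideanSpace.real_norm_sq_eq,
        norm_eq_of_mem_sphere]
      simp
    simp [e]
  simp_rw [h1] at h2
  rw [Finset.sum_const, Finset.card_univ, Fintype.card_fin, nsmul_eq_mul] at h2
  rw [ENNReal.ofReal_div_of_pos (by positivity), ENNReal.ofReal_one,
    ENNReal.eq_div_iff (by simp; positivity) ENNReal.ofReal_ne_top, ← h2]
  congr 1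
  rw [← ENNReal.ofReal_natCast]
  push_cast
  rfl

/-- Rotation invariance exchanges e₀ and -e₀, so the positive and negative parts have equal
integrals. -/
theorem integral_coordinate (d : ℕ) :
    ∫ ω : Sph (d + 1), (ω : EuclideanSpace ℝ (Fin (d + 1))) 0 ∂unif (d + 1) = 0 := by
  have := isProbabilityMeasure_unif (d + 1) (by omega)
  have hint : Integrable (fun ω : Sph (d + 1) => (ω : EuclideanSpace ℝ (Fin (d + 1))) 0)
      (unif (d + 1)) := by
    obtain ⟨M, hM⟩ := exists_bound_of_continuous (contMDiff_coordinate d).continuous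
    exact Integrable.of_bound (Measurable.aestronglyMeasurable (by fun_prop)) M
      (Eventually.of_forall hM)
  rw [integral_eq_lintegral_pos_part_sub_lintegral_neg_part hint]
  have h := lintegral_unif_inner (n := d + 1) (φ := fun a => ENNReal.ofReal a)
    (by fun_prop) ⟨EuclideanSpace.single 0 1, by simp⟩ ⟨-EuclideanSpace.single 0 1, by simp⟩
  simp only [EuclideanSpace.inner_single_left, inner_neg_left] at h
  simp at h
  rw [h, sub_self]

theorem covariance_coordinate (d : ℕ) :
    ‖cov[fun ω : Sph (d + 1) => (ω : EuclideanSpace ℝ (Fin (d + 1))) 0,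
      fun ω : Sph (d + 1) => (ω : EuclideanSpace ℝ (Fin (d + 1))) 0; unif (d + 1)]‖ₑ =
      ENNReal.ofReal (1 / ((d : ℝ) + 1)) := by
  rw [covariance, integral_coordinate, ← lintegral_coordinate_sq]
  simp_rw [sub_zero, ← sq]
  rw [Real.enorm_of_nonneg (integral_nonneg fun _ => sq_nonneg _),
    ofReal_integral_eq_lintegral_ofReal _ (Eventually.of_forall fun _ => sq_nonneg _)]
  have := isProbabilityMeasure_unif (d + 1) (by omega)
  obtain ⟨M, hM⟩ := exists_bound_of_continuous ((contMDiff_coordinate d).continuous.pow 2)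
  exact Integrable.of_bound (Measurable.aestronglyMeasurable (by fun_prop)) M
    (Eventually.of_forall hM)

/-- Positivity of the density transfers almost sure statements from the mixing measure to σ ⊗ σ,
where full support and continuity can be used. -/
theorem mixingDensity_ne_zero {n : ℕ} (hn : 1 ≤ n) (α : ℝ) : mixingDensity n α ≠ 0 := by
  have hn' : (0 : ℝ) < n := by exact_mod_cast hn
  have hΓ : 0 < Real.Gamma ((n : ℝ) / 2) := Real.Gamma_pos_of_pos (by positivity)
  have hpos : ∀ {s : Set ℝ} {h : ℝ → ℝ≥0∞}, MeasurableSet s → Measurable h → volume s ≠ 0 →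
      (∀ x ∈ s, h x ≠ 0) → ∫⁻ x in s, h x ≠ 0 := by
    intro s h hs hh h0 hx
    rw [← pos_iff_ne_zero, setLIntegral_pos_iff hh, pos_iff_ne_zero]
    rwa [inter_eq_right.2 (show s ⊆ Function.support h from hx)]
  rw [mixingDensity_eq]
  refine mul_ne_zero (ENNReal.ofReal_pos.2 (by positivity)).ne'
    (hpos measurableSet_Ioo (by fun_prop) (by simp) ?_)
  intro t ht
  have hs : 0 < √(1 - t ^ 2) := Real.sqrt_pos.2 (by nlinarith [ht.1, ht.2])
  refine mul_ne_zero (ENNReal.ofReal_pos.2 (by positivity)).ne'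
    (hpos measurableSet_Ioi ?_ (by simp) ?_)
  · refine Measurable.lintegral_prod_right' (f := fun p : ℝ × ℝ => ENNReal.ofReal
      (Real.exp (-(p.1 ^ 2 + p.2 ^ 2 - 2 * p.1 * p.2 * t * α) / 2) * (p.1 * p.2) ^ (n - 2))) ?_
    fun_prop
  intro r (hr : 0 < r)
  refine hpos measurableSet_Ioi (by fun_prop) (by simp) fun s (hs : 0 < s) => ?_
  have : 0 < Real.exp (-(r ^ 2 + s ^ 2 - 2 * r * s * t * α) / 2) * (r * s) ^ (n - 2) := by
    positivity
  simpa using this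

theorem ae_of_ae_mixingMeasure {n : ℕ} (hn : 1 ≤ n) {P : Sph n × Sph n → Prop}
    (h : ∀ᵐ z ∂mixingMeasure n, P z) : ∀ᵐ z ∂((unif n).prod (unif n)), P z := by
  have hmd : Measurable fun p : Sph n × Sph n => mixingDensity n
      ⟪(p.1 : EuclideanSpace ℝ (Fin n)), (p.2 : EuclideanSpace ℝ (Fin n))⟫ := by fun_prop
  filter_upwards [(ae_withDensity_iff hmd).1 h] with z hz
  exact hz (mixingDensity_ne_zero hn _)

theorem isOpenPosMeasure_unif (n : ℕ) : (unif n).IsOpenPosMeasure := by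
  constructor
  intro U hU hne
  rw [unif, Measure.smul_apply, smul_eq_mul]
  exact mul_ne_zero (ENNReal.inv_ne_zero.2 (measure_ne_top _ _)) (hU.measure_ne_zero _ hne)

/-- The squares of the first coordinates are not almost surely equal under the mixing measure. -/
theorem not_ae_coordinate_sq_eq (hd : 1 ≤ d) :
    ¬ ∀ᵐ z ∂mixingMeasure (d + 1), (z.1 : EuclideanSpace ℝ (Fin (d + 1))) 0 ^ 2 =
      (z.2 : EuclideanSpace ℝ (Fin (d + 1))) 0 ^ 2 := by
  intro h
  have := isProbabilityMeasure_unif (d + 1) (by omega)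
  have := isOpenPosMeasure_unif (d + 1)
  obtain ⟨x, hx⟩ := (Measure.ae_ae_of_ae_prod (ae_of_ae_mixingMeasure (by omega) h)).exists
  have heq : (fun z : Sph (d + 1) => (x : EuclideanSpace ℝ (Fin (d + 1))) 0 ^ 2) =
      fun z : Sph (d + 1) => (z : EuclideanSpace ℝ (Fin (d + 1))) 0 ^ 2 :=
    (Continuous.ae_eq_iff_eq (unif (d + 1)) continuous_const
      ((contMDiff_coordinate d).continuous.pow 2)).1 hx
  -- By continuity and full support the identity holds everywhere, yet the squared first coordinate
  -- is 1 at the first basis vector and 0 at the last, which are distinct since d ≥ 1.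
  have h0 := congrFun heq ⟨EuclideanSpace.single 0 1, by simp⟩
  have h1 := congrFun heq ⟨EuclideanSpace.single (Fin.last d) 1, by simp⟩
  have hne : (0 : Fin (d + 1)) ≠ Fin.last d := by
    intro h
    have := congrArg Fin.val h
    simp at this
    omega
  rw [h0] at h1
  simp [hne] at h1

/-- The covariance bound is tested on X = x₀ paired with itself. Strict AM-GM and the marginals give
1/(d+1) < cₙ E(1 - X²) = cₙ d/(d+1), with n = d + 1. -/
theorem lt_mixingConst (hd : 1 ≤ d) : 1 / (d : ℝ) < mixingConst (d + 1) := by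
  have := isProbabilityMeasure_unif (d + 1) (by omega)
  have := isFiniteMeasure_mixingMeasure (n := d + 1) (by omega)
  have hd' : (1 : ℝ) ≤ d := by exact_mod_cast hd
  set X : Sph (d + 1) → ℝ := fun ω => (ω : EuclideanSpace ℝ (Fin (d + 1))) 0 with hX
  have hXc : Continuous X := (contMDiff_coordinate d).continuous
  have hXm : Measurable X := hXc.measurable
  have hX1 : ∀ ω, X ω ^ 2 ≤ 1 := by
    intro ω
    have h := EuclideanSpace.real_norm_sq_eq (ω : EuclideanSpace ℝ (Fin (d + 1)))
    rw [norm_eq_of_mem_sphere, one_pow] at h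
    rw [h]
    exact Finset.single_le_sum (f := fun i => (ω : EuclideanSpace ℝ (Fin (d + 1))) i ^ 2)
      (fun i _ => sq_nonneg _) (Finset.mem_univ 0)
  have h1 := enorm_covariance_le hd (contMDiff_coordinate d) (contMDiff_coordinate d)
  rw [covariance_coordinate] at h1
  have hamgm : ∀ a b : ℝ, a ^ 2 ≤ 1 → b ^ 2 ≤ 1 → a ^ 2 ≠ b ^ 2 →
      √(1 - a ^ 2) * √(1 - b ^ 2) < 1 / 2 * (1 - a ^ 2) + 1 / 2 * (1 - b ^ 2) := by
    intro a b ha hb hab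
    have e1 := Real.sq_sqrt (sub_nonneg.2 ha)
    have e2 := Real.sq_sqrt (sub_nonneg.2 hb)
    have e3 : √(1 - a ^ 2) - √(1 - b ^ 2) ≠ 0 := by
      intro h
      rw [sub_eq_zero] at h
      rw [h] at e1
      exact hab (by linarith)
    nlinarith [sq_pos_of_ne_zero e3]
  have hamgm' : ∀ a b : ℝ, a ^ 2 ≤ 1 → b ^ 2 ≤ 1 →
      √(1 - a ^ 2) * √(1 - b ^ 2) ≤ 1 / 2 * (1 - a ^ 2) + 1 / 2 * (1 - b ^ 2) := by
    intro a b ha hb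
    nlinarith [Real.sq_sqrt (sub_nonneg.2 ha), Real.sq_sqrt (sub_nonneg.2 hb),
      sq_nonneg (√(1 - a ^ 2) - √(1 - b ^ 2))]
  have h2 : ∫⁻ p, ‖sgrad X p.1‖ₑ * ‖sgrad X p.2‖ₑ ∂mixingMeasure (d + 1) =
      ∫⁻ p, ENNReal.ofReal (√(1 - X p.1 ^ 2) * √(1 - X p.2 ^ 2)) ∂mixingMeasure (d + 1) := by
    refine lintegral_congr fun p => ?_
    rw [← ofReal_norm, ← ofReal_norm, norm_sgrad_coordinate, norm_sgrad_coordinate,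
      ENNReal.ofReal_mul (Real.sqrt_nonneg _)]
  rw [h2] at h1
  have hX2 : ∫⁻ ω, ENNReal.ofReal (1 - X ω ^ 2) ∂unif (d + 1) =
      ENNReal.ofReal (d / ((d : ℝ) + 1)) := by
    have h := lintegral_coordinate_sq d
    simp_rw [ENNReal.ofReal_sub 1 (sq_nonneg _)]
    rw [lintegral_sub (by fun_prop) (by rw [h]; exact ENNReal.ofReal_ne_top)
      (Eventually.of_forall fun ω => ENNReal.ofReal_le_ofReal (hX1 ω)), h]
    rw [lintegral_const, measure_univ, mul_one, ← ENNReal.ofReal_sub _ (by positivity)]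
    congr 1
    field_simp
    ring
  have e1 : ∫⁻ p, ENNReal.ofReal (1 - X p.1 ^ 2) ∂mixingMeasure (d + 1) =
      mixingMeasure (d + 1) univ * ENNReal.ofReal (d / ((d : ℝ) + 1)) := by
    rw [← hX2, ← smul_eq_mul, ← lintegral_smul_measure, ← mixingMeasure_map_fst,
      lintegral_map (by fun_prop) measurable_fst]
  have e2 : ∫⁻ p, ENNReal.ofReal (1 - X p.2 ^ 2) ∂mixingMeasure (d + 1) =
      mixingMeasure (d + 1) univ * ENNReal.ofReal (d / ((d : ℝ) + 1)) := by
    rw [← hX2, ← smul_eq_mul, ← lintegral_smul_measure, ← mixingMeasure_map_snd,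
      lintegral_map (by fun_prop) measurable_snd]
  have h3 : ∫⁻ p, ENNReal.ofReal (1 / 2 * (1 - X p.1 ^ 2) + 1 / 2 * (1 - X p.2 ^ 2))
      ∂mixingMeasure (d + 1) = mixingMeasure (d + 1) univ * ENNReal.ofReal (d / ((d : ℝ) + 1)) := by
    have e3 : ∀ p : Sph (d + 1) × Sph (d + 1),
        ENNReal.ofReal (1 / 2 * (1 - X p.1 ^ 2) + 1 / 2 * (1 - X p.2 ^ 2)) =
        ENNReal.ofReal (1 / 2) * ENNReal.ofReal (1 - X p.1 ^ 2) +
        ENNReal.ofReal (1 / 2) * ENNReal.ofReal (1 - X p.2 ^ 2) := fun p => by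
      have a1 := hX1 p.1
      have a2 := hX1 p.2
      rw [ENNReal.ofReal_add (by linarith) (by linarith), ENNReal.ofReal_mul (by norm_num),
        ENNReal.ofReal_mul (by norm_num)]
    simp_rw [e3]
    rw [lintegral_add_left (by fun_prop), lintegral_const_mul _ (by fun_prop),
      lintegral_const_mul _ (by fun_prop), e1, e2, ← add_mul,
      ← ENNReal.ofReal_add (by norm_num) (by norm_num)]
    norm_num
  have h4 : ∫⁻ p, ENNReal.ofReal (√(1 - X p.1 ^ 2) * √(1 - X p.2 ^ 2)) ∂mixingMeasure (d + 1) <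
      ∫⁻ p, ENNReal.ofReal (1 / 2 * (1 - X p.1 ^ 2) + 1 / 2 * (1 - X p.2 ^ 2))
        ∂mixingMeasure (d + 1) := by
    have hle : ∀ p : Sph (d + 1) × Sph (d + 1),
        ENNReal.ofReal (√(1 - X p.1 ^ 2) * √(1 - X p.2 ^ 2)) ≤
        ENNReal.ofReal (1 / 2 * (1 - X p.1 ^ 2) + 1 / 2 * (1 - X p.2 ^ 2)) := fun p =>
      ENNReal.ofReal_le_ofReal (hamgm' _ _ (hX1 _) (hX1 _))
    refine lintegral_strict_mono_of_ae_le_of_frequently_ae_lt (by fun_prop) ?_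
      (Eventually.of_forall hle) ?_
    · refine ne_top_of_le_ne_top ?_ (lintegral_mono hle)
      rw [h3]
      exact ENNReal.mul_ne_top (measure_ne_top _ _) ENNReal.ofReal_ne_top
    · intro h
      refine not_ae_coordinate_sq_eq hd (h.mono fun p hp => ?_)
      by_contra hne
      refine hp fun heq => ?_
      have hlt := hamgm _ _ (hX1 p.1) (hX1 p.2) hne
      exact ((ENNReal.ofReal_lt_ofReal_iff
        (lt_of_le_of_lt (by positivity) hlt)).2 hlt).ne heq
  have h5 := h1.trans_lt (h4.trans_eq h3)
  rw [← ENNReal.ofReal_toReal (measure_ne_top (mixingMeasure (d + 1)) univ),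
    ← ENNReal.ofReal_mul ENNReal.toReal_nonneg] at h5
  have h6 := (ENNReal.ofReal_lt_ofReal_iff_of_nonneg (by positivity)).1 h5
  change 1 / ((d : ℝ) + 1) < mixingConst (d + 1) * (d / ((d : ℝ) + 1)) at h6
  rw [mul_div_assoc', div_lt_div_iff_of_pos_right (by positivity)] at h6
  rwa [div_lt_iff₀ (by linarith)]

end coordinate

/-! ### Covariance inequalities in real form -/

variable {d : ℕ} {f g : Sph (d + 1) → ℝ}

theorem memLp_sgrad (hf : ContMDiff (𝓡 d) 𝓘(ℝ, ℝ) 1 f) (p : ℝ≥0∞) :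
    MemLp (sgrad f) p (unif (d + 1)) := by
  have := isProbabilityMeasure_unif (d + 1) (by omega)
  obtain ⟨K, hK⟩ := exists_bound_of_continuous (continuous_sgrad hf)
  exact MemLp.of_bound (continuous_sgrad hf).aestronglyMeasurable K (Eventually.of_forall hK)

theorem abs_covariance_le (hd : 1 ≤ d) (hf : ContMDiff (𝓡 d) 𝓘(ℝ, ℝ) 1 f)
    (hg : ContMDiff (𝓡 d) 𝓘(ℝ, ℝ) 1 g) {p q : ℝ≥0∞} (hpq : 1 / p + 1 / q = 1) :
    |cov[f, g; unif (d + 1)]| ≤ mixingConst (d + 1) * gradNorm f p * gradNorm g q := by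
  have := isFiniteMeasure_mixingMeasure (n := d + 1) (by omega)
  have h := (enorm_covariance_le hd hf hg).trans
    (lintegral_mixingMeasure_le (memLp_sgrad hf p).1 (memLp_sgrad hg q).1 hpq)
  have h' := ENNReal.toReal_mono (ENNReal.mul_ne_top (ENNReal.mul_ne_top (measure_ne_top _ _)
    (memLp_sgrad hf p).2.ne) (memLp_sgrad hg q).2.ne) h
  rwa [toReal_enorm, Real.norm_eq_abs, ENNReal.toReal_mul, ENNReal.toReal_mul] at h'

theorem abs_covariance_le_of_lipschitz (hd : 1 ≤ d) (hf : ContMDiff (𝓡 d) 𝓘(ℝ, ℝ) 1 f)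
    (hg : ContMDiff (𝓡 d) 𝓘(ℝ, ℝ) 1 g)
    (hlip : ∀ x y : Sph (d + 1), |f x - f y| ≤
      InnerProductGeometry.angle (x : EuclideanSpace ℝ (Fin (d + 1))) y) :
    |cov[f, g; unif (d + 1)]| ≤ mixingConst (d + 1) * ∫ x, ‖sgrad g x‖ ∂unif (d + 1) := by
  -- The endpoint pair of exponents: a 1-Lipschitz f has gradient norm at most 1 in L^∞.
  have h := abs_covariance_le hd hf hg (p := ∞) (q := 1) (by simp)
  have h1 : gradNorm f ∞ ≤ 1 := by
    refine ENNReal.toReal_le_of_le_ofReal zero_le_one ?_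
    rw [eLpNorm_exponent_top]
    refine eLpNormEssSup_le_of_ae_bound (Eventually.of_forall fun ω => norm_sgrad_le_one hf hlip ω)
  have h2 : gradNorm g 1 = ∫ x, ‖sgrad g x‖ ∂unif (d + 1) := by
    rw [gradNorm, eLpNorm_one_eq_lintegral_enorm,
      integral_norm_eq_lintegral_enorm (memLp_sgrad hg 1).1]
  rw [h2] at h
  refine h.trans (mul_le_mul_of_nonneg_right ?_ (integral_nonneg fun _ => norm_nonneg _))
  exact mul_le_of_le_one_right measureReal_nonneg h1

end SphereCov

end

/-- The sphere is the unit sphere of `ℝⁿ` with `n = d + 1 ≥ 2`. -/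
theorem corollary11p1 (d : ℕ) (hd : 1 ≤ d) :
    (2 ≤ d →
      1 / (d : ℝ) < SphereCov.mixingConst (d + 1) ∧
        SphereCov.mixingConst (d + 1) < 1 / ((d : ℝ) - 1)) ∧
    ∀ f g : SphereCov.Sph (d + 1) → ℝ,
      ContMDiff (𝓡 d) 𝓘(ℝ, ℝ) 1 f → ContMDiff (𝓡 d) 𝓘(ℝ, ℝ) 1 g →
      (∀ p q : ℝ≥0∞, 1 ≤ p → 1 ≤ q → 1 / p + 1 / q = 1 →
        |cov[f, g; SphereCov.unif (d + 1)]| ≤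
          SphereCov.mixingConst (d + 1) * SphereCov.gradNorm f p * SphereCov.gradNorm g q) ∧
      ((∀ x y : SphereCov.Sph (d + 1), |f x - f y| ≤
          InnerProductGeometry.angle (x : EuclideanSpace ℝ (Fin (d + 1))) y) →
        |cov[f, g; SphereCov.unif (d + 1)]| ≤
          SphereCov.mixingConst (d + 1) *
            ∫ x, ‖SphereCov.sgrad g x‖ ∂(SphereCov.unif (d + 1))) := by
  refine ⟨fun h2 => ⟨SphereCov.lt_mixingConst hd, ?_⟩, fun f g hf hg =>
    ⟨fun p q _ _ hpq => SphereCov.abs_covariance_le hd hf hg hpq,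
      SphereCov.abs_covariance_le_of_lipschitz hd hf hg⟩⟩
  have h := SphereCov.mixingConst_lt (n := d + 1) (by omega)
  have e : ((d + 1 : ℕ) : ℝ) - 2 = (d : ℝ) - 1 := by push_cast; ring
  rwa [e] at h
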